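/- **Setting.** Let $d\ge 1$, let $\Omega\subset\mathbb R^d$ be a bounded Lipschitz domain, $T>0$, $\Omega_T=\Omega\times(0,T)$, $\mathbf f\in C^2(\mathbb R;\mathbb R^d)$, and $\nabla\cdot\mathbf F(v)=\partial_t v+\nabla_{\mathbf x}\cdot\mathbf f(v)$. Fix $c>0$ and $u_0\in L^\infty(\mathbb R^d)$ with compact support. Let $\Lambda_h$ be a conforming partition of $\overline{\Omega_T}$ into finitely many closed axis-parallel boxes and simplices which is shape-regular (each cell $K$ contains a ball of radius $\operatorname{diam}(K)/\kappa$) and quasi-uniform ($h\le\kappa\operatorname{diam}K$ for each $K$), with $h=\max_{K}\operatorname{diam}K$. Let $V_h^c$ be the set of functions $k_h$ that on each cell $K$ are polynomials of degree at most one in each variable ($K$ a box) or of total degree at most one ($K$ a simplex) and satisfy $\max_K\bigl(\|k_h\|_{L^\infty(K)}+h\|\nabla k_h\|_{L^\infty(K)}\bigr)\le c$. With $\operatorname{sgn}(0)=0$, put $$\mathcal L(v)=\sup_{k_h\in V_h^c}\int_{\Omega_T}\nabla\cdot\mathbf F(v)\,\operatorname{sgn}(v-k_h)\,d\mathbf z+h\int_{\Omega_T}|\nabla\cdot\mathbf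 F(v)|\,d\mathbf z+\|v(\cdot,0)-u_0\|_{L^1(\Omega)}+\|v\|_{L^1(\partial\Omega\times(0,T))}.$$ A clipped $\tanh$ network is a function $u_\theta=\min\{\max\{U_\theta,-\tfrac c2\},\tfrac c2\}$ with $U_\theta=A_L\circ\tanh\circ A_{L-1}\circ\cdots\circ\tanh\circ A_1$, where the $A_\ell$ are affine and $\tanh$ acts componentwise; its depth is $L$, its width the largest number of neurons in a hidden layer. **Lemma.** There are constants $C_1,C_2,C_3$ depending only on $d$, and a constant $C>0$ depending only on $d,\Omega,T,\mathbf f,c,C_\Omega,C_\nabla,\kappa$ (in particular not on $h$, $\Lambda_h$, $\hat u$ or the network), such that the following holds. Let $\hat u$ be continuous on $\overline{\Omega_T}$ and affine on each element of a conforming simplicial partition $\mathcal T$ of $\overline{\Omega_T}$ with $N=\#\mathcal T$ elements, each vertex of which belongs to at most $N_{\rm patch}$ elements. Assume that $\|\hat u\|_{L^\infty(\Omega_T)}\le \frac c2-\delta_c$ for some $\delta_c>0$, that $\|\nabla\hat u\|_{L^1(\Omega_T)}\le C_\nabla$, and that $\Omega_T=\Omega_r\cup\Omega_s$ with disjoint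 measurable sets $\Omega_r,\Omega_s$ with Lipschitz boundaries such that $|\partial\Omega_s|\le C_\Omega$, $|\Omega_s|\le C_\Omega h^2$ (with $|\partial\Omega_s|$ the surface measure), and $\hat u$ is affine on each element of some conforming simplicial partition of $\overline{\Omega_r}$ that is shape-regular with constant $\kappa$ and has mesh size at most $\kappa h$. Then there is a clipped $\tanh$ network $u_{\hat\theta}$ of depth at most $C_1\lceil\log_2 N_{\rm patch}\rceil+C_2$ and width at most $C_3\,N\,N_{\rm patch}$ with $$\mathcal L(u_{\hat\theta})\le\mathcal L(\hat u)+C\Bigl(h+\int_{\Omega_r}|\nabla\cdot\mathbf F(\hat u)|\,d\mathbf z\Bigr).$$ -/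

import Mathlib

open MeasureTheory Set
open scoped ENNReal NNReal

noncomputable section

namespace CLaw

/-- Euclidean space `ℝⁿ`. Space-time `ℝᵈ⁺¹` is `Eucl (d + 1)`: the coordinates `0, …, d - 1` are the
space variables and the last coordinate is the time. -/
abbrev Eucl (n : ℕ) : Type := EuclideanSpace ℝ (Fin n)

/-- The spatial part `x` of `z = (x, t)`. -/
def spacePart {d : ℕ} (z : Eucl (d + 1)) : Eucl d :=
  WithLp.toLp 2 fun i : Fin d => z i.castSucc

/-- The time `t` of `z = (x, t)`. -/
def timePart {d : ℕ} (z : Eucl (d + 1)) : ℝ := z (Fin.last d)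

/-- The space-time point `(x, t)`. -/
def stPoint {d : ℕ} (x : Eucl d) (t : ℝ) : Eucl (d + 1) :=
  WithLp.toLp 2 (Fin.snoc (α := fun _ => ℝ) (fun i => x i) t)

/-- The space-time cylinder `Ω_T = Ω × (0, T)`. -/
def cylinder {d : ℕ} (Ω : Set (Eucl d)) (T : ℝ) : Set (Eucl (d + 1)) :=
  {z | spacePart z ∈ Ω ∧ timePart z ∈ Ioo 0 T}

/-- The lateral boundary `∂Ω × (0, T)`. -/
def lateralBoundary {d : ℕ} (Ω : Set (Eucl d)) (T : ℝ) : Set (Eucl (d + 1)) :=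
  {z | spacePart z ∈ frontier Ω ∧ timePart z ∈ Ioo 0 T}

/-- `S` has a Lipschitz boundary: near each boundary point there are a unit direction `e` and a
Lipschitz function `φ` of the variables orthogonal to `e` such that, locally, `S` is the set of
points above the graph of `φ` in direction `e` (up to points of the graph itself, so that the notion
applies to sets that are neither open nor closed). -/
def HasLipschitzBoundary {n : ℕ} (S : Set (Eucl n)) : Prop :=
  ∀ x ∈ frontier S, ∃ (e : Eucl n) (φ : Eucl n → ℝ) (M : ℝ≥0) (r : ℝ),
    ‖e‖ = 1 ∧ LipschitzWith M φ ∧ (∀ (y : Eucl n) (s : ℝ), φ (y + s • e) = φ y) ∧ 0 < r ∧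
    ∀ y ∈ Metric.ball x r,
      (φ y < inner ℝ e y → y ∈ S) ∧ (inner ℝ e y < φ y → y ∉ S)

/-! ### Meshes -/

/-- `K` is a nondegenerate closed axis-parallel box. -/
def IsBoxCell {n : ℕ} (K : Set (Eucl n)) : Prop :=
  ∃ a b : Eucl n, (∀ i, a i < b i) ∧ K = {z | ∀ i, a i ≤ z i ∧ z i ≤ b i}

/-- `K` is a nondegenerate closed `n`-simplex. -/
def IsSimplexCell {n : ℕ} (K : Set (Eucl n)) : Prop :=
  ∃ p : Fin (n + 1) → Eucl n, AffineIndependent ℝ p ∧ K = convexHull ℝ (range p)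

/-- The finite family `cells` is a conforming partition of the closure of `D` into closed boxes and
simplices: the intersection of two different cells is a common (possibly empty) face. For polytopes
the faces are the exposed subsets. -/
structure IsConformingPartition {n : ℕ} (cells : Finset (Set (Eucl n))) (D : Set (Eucl n)) :
    Prop where
  isCell : ∀ K ∈ cells, IsBoxCell K ∨ IsSimplexCell K
  covers : (⋃ K ∈ cells, K) = closure D
  conforming : ∀ K ∈ cells, ∀ K' ∈ cells, K ≠ K' →
    IsExposed ℝ K (K ∩ K') ∧ IsExposed ℝ K' (K ∩ K')

/-- A conforming partition all of whose cells are simplices. -/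
def IsSimplicialPartition {n : ℕ} (cells : Finset (Set (Eucl n))) (D : Set (Eucl n)) : Prop :=
  IsConformingPartition cells D ∧ ∀ K ∈ cells, IsSimplexCell K

/-- The mesh size `h = max_K diam K`. -/
def meshSize {n : ℕ} (cells : Finset (Set (Eucl n))) : ℝ :=
  ((cells.sup fun K => (Metric.diam K).toNNReal : ℝ≥0) : ℝ)

/-- Shape regularity with constant `κ`: every cell `K` contains a ball of radius `diam K / κ`. -/
def IsShapeRegular {n : ℕ} (κ : ℝ) (cells : Finset (Set (Eucl n))) : Prop :=
  ∀ K ∈ cells, ∃ z, Metric.closedBall z (Metric.diam K / κ) ⊆ K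

/-- Quasi-uniformity with constant `κ`: `h ≤ κ diam K` for every cell `K`. -/
def IsQuasiUniform {n : ℕ} (κ : ℝ) (cells : Finset (Set (Eucl n))) : Prop :=
  ∀ K ∈ cells, meshSize cells ≤ κ * Metric.diam K

/-- Every vertex of the partition belongs to at most `P` cells. -/
def PatchBound {n : ℕ} (cells : Finset (Set (Eucl n))) (P : ℕ) : Prop :=
  ∀ K ∈ cells, ∀ v ∈ extremePoints ℝ K, {K' : Set (Eucl n) | K' ∈ cells ∧ v ∈ K'}.ncard ≤ P

/-- `v` is continuous on the closure of `D` and affine on each cell. -/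
def IsCPwL {n : ℕ} (cells : Finset (Set (Eucl n))) (D : Set (Eucl n)) (v : Eucl n → ℝ) : Prop :=
  ContinuousOn v (closure D) ∧ ∀ K ∈ cells, ∃ A : Eucl n →ᵃ[ℝ] ℝ, EqOn v A K

/-! ### The discrete test space -/

/-- `k ∈ V_h`: inside each cell `k` is a polynomial of degree at most one in each variable if the
cell is a box, and of total degree at most one if it is a simplex. The values on the skeleton, a
null set, are left free. -/
def MemVh {n : ℕ} (cells : Finset (Set (Eucl n))) (k : Eucl n → ℝ) : Prop :=
  ∀ K ∈ cells, ∃ p : MvPolynomial (Fin n) ℝ,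
    (IsBoxCell K → ∀ i, p.degreeOf i ≤ 1) ∧ (IsSimplexCell K → p.totalDegree ≤ 1) ∧
    ∀ z ∈ interior K, k z = MvPolynomial.eval (fun i => z i) p

/-- The mesh-dependent norm `max_K (‖k‖_{L^∞(K)} + h ‖∇k‖_{L^∞(K)})`. -/
def normW1h {n : ℕ} (cells : Finset (Set (Eucl n))) (k : Eucl n → ℝ) : ℝ≥0∞ :=
  ⨆ K ∈ cells, (eLpNorm k ∞ (volume.restrict K)
    + ENNReal.ofReal (meshSize cells) * eLpNorm (gradient k) ∞ (volume.restrict K))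

/-- The bounded class `V_h^c` of discontinuous piecewise polynomials. -/
def Vhc {n : ℕ} (cells : Finset (Set (Eucl n))) (c : ℝ) : Set (Eucl n → ℝ) :=
  {k | MemVh cells k ∧ normW1h cells k ≤ ENNReal.ofReal c}

/-! ### The loss functional -/

/-- The partial derivative `∂v/∂z_i`. -/
def partialDeriv {n : ℕ} (i : Fin n) (v : Eucl n → ℝ) (z : Eucl n) : ℝ :=
  fderiv ℝ v z (EuclideanSpace.single i 1)

/-- `∇·F(v) = ∂_t v + ∇_x·f(v)` (used for Lipschitz `v` only, hence defined almost everywhere). -/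
def divF {d : ℕ} (f : ℝ → Eucl d) (v : Eucl (d + 1) → ℝ) (z : Eucl (d + 1)) : ℝ :=
  partialDeriv (Fin.last d) v z + ∑ i : Fin d, partialDeriv i.castSucc (fun y => f (v y) i) z

/-- `J_ent(v; k) = ∫_{Ω_T} ∇·F(v) sgn(v - k)`, with `sgn 0 = 0`. -/
def entropyResidual {d : ℕ} (f : ℝ → Eucl d) (Ω : Set (Eucl d)) (T : ℝ)
    (v k : Eucl (d + 1) → ℝ) : ℝ :=
  ∫ z in cylinder Ω T, divF f v z * Real.sign (v z - k z)

/-- `L_ent(v) = sup_{k ∈ V_h^c} J_ent(v; k)`. -/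
def lossEnt {d : ℕ} (f : ℝ → Eucl d) (Ω : Set (Eucl d)) (T : ℝ)
    (Λ : Finset (Set (Eucl (d + 1)))) (c : ℝ) (v : Eucl (d + 1) → ℝ) : ℝ :=
  ⨆ k : Vhc Λ c, entropyResidual f Ω T v k

/-- `L_reg(v) = h ∫_{Ω_T} |∇·F(v)|`. -/
def lossReg {d : ℕ} (f : ℝ → Eucl d) (Ω : Set (Eucl d)) (T : ℝ)
    (Λ : Finset (Set (Eucl (d + 1)))) (v : Eucl (d + 1) → ℝ) : ℝ :=
  meshSize Λ * ∫ z in cylinder Ω T, |divF f v z|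

/-- `L_ibc(v) = ‖v(·,0) - u₀‖_{L¹(Ω)} + ‖v‖_{L¹(∂Ω×(0,T))}`, for `v` continuous up to the boundary;
`μHE[d]` is the `d`-dimensional surface measure. -/
def lossIbc {d : ℕ} (Ω : Set (Eucl d)) (T : ℝ) (u₀ : Eucl d → ℝ) (v : Eucl (d + 1) → ℝ) : ℝ :=
  (∫ x in Ω, |v (stPoint x 0) - u₀ x|) + ∫ z in lateralBoundary Ω T, |v z| ∂μHE[d]

/-- The total loss `L = L_ent + L_reg + L_ibc`. -/
def loss {d : ℕ} (f : ℝ → Eucl d) (Ω : Set (Eucl d)) (T : ℝ) (u₀ : Eucl d → ℝ)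
    (Λ : Finset (Set (Eucl (d + 1)))) (c : ℝ) (v : Eucl (d + 1) → ℝ) : ℝ :=
  lossEnt f Ω T Λ c v + lossReg f Ω T Λ v + lossIbc Ω T u₀ v

/-! ### Clipped tanh networks -/

/-- Parameters of a fully connected network with `m` inputs and one output: a finite list of weight
matrices and biases, either a final affine map to `ℝ`, or an affine map to `ℝⁿ` (followed by the
activation) and then the parameters of a network with `n` inputs. -/
inductive NetParams : ℕ → Type
  | out {m : ℕ} (W : Fin m → ℝ) (b : ℝ) : NetParams m
  | hidden {m n : ℕ} (W : Matrix (Fin n) (Fin m) ℝ) (b : Fin n → ℝ) (rest : NetParams n) :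
      NetParams m

namespace NetParams

/-- The raw network `A_L ∘ tanh ∘ A_{L-1} ∘ ⋯ ∘ tanh ∘ A_1`. -/
def raw : {m : ℕ} → NetParams m → (Fin m → ℝ) → ℝ
  | _, out W b, y => (∑ i, W i * y i) + b
  | _, hidden W b rest, y => rest.raw fun j => Real.tanh (W.mulVec y j + b j)

/-- The number `L` of affine maps. -/
def depth : {m : ℕ} → NetParams m → ℕ
  | _, out _ _ => 1
  | _, hidden _ _ rest => rest.depth + 1

/-- The largest number of neurons in a hidden layer. -/
def width : {m : ℕ} → NetParams m → ℕ
  | _, out _ _ => 0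
  | _, hidden (n := n) _ _ rest => max n rest.width

end NetParams

/-- The clipping `Π_c(r) = min {max {r, -c/2}, c/2}`. -/
def clip (c r : ℝ) : ℝ := min (max r (-(c / 2))) (c / 2)

/-- The clipped tanh network `u_θ = Π_c ∘ U_θ`. -/
def clippedNet {m : ℕ} (c : ℝ) (θ : NetParams m) (z : Eucl m) : ℝ :=
  clip c (θ.raw fun i => z i)

end CLaw

end

open CLaw

/-! The function û is written exactly as a network of rectifiers, and the rectifiers are then
smoothed into tanh networks of a fixed size. A late enough member of this sequence is the required
network: its size does not depend on how close it must be, so the closeness may depend on û, δ_c and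
the mesh.

Representation (`exists_netLimit_eqOn`). Expand û = Σ_v û(v) φ_v in hat functions. Vertex patches
need not be convex, so φ_v is in general not a minimum of its affine pieces. Instead φ_v = max(0,
max_K (λ_v^K − M Σ_j max(−λ_j^K, 0))), where K runs over the cells at v and λ^K are barycentric
coordinates. Conformity provides an M for which the term of K lies below φ_v on every other cell
(`exists_hatOn_sub_le`). A binary tree of maxima makes the depth logarithmic in the patch size.

Smoothing. The identity tanh a − tanh(a+b) + tanh b = tanh a · tanh b · tanh(a+b) lets one layer
multiply a small multiple of x by a smoothed Heaviside function. The resulting `softRelu k` is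
Lipschitz uniformly in k and converges to the rectifier, with its derivative away from 0. All
functions involved have finitely many affine pieces, so gradients converge almost everywhere through
all layers (`AELimit.relu`). Hence values converge uniformly on bounded sets and ∇·F converges in L¹
(`AELimit.tendsto_integral_divF`), which settles the regularization, initial and boundary terms.

Entropy term (`exists_entropyResidual_le`). The sign is discontinuous and the estimate must be
uniform in the test function k. For |v − û| < η the signs of v − k and û − k differ only where |û −
k| ≤ η. On Ω_r this costs at most 2∫|∇·F(û)|. On Ω_s there are two cases. Where |∇û| ≤ 2c/h, the
integrand is O(1/h) on a set of measure O(h²), a contribution O(h). Where |∇û| > 2c/h, subtracting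
k, whose gradient is at most c/h, leaves a slope at least c/h in a fixed direction, so the set {|û −
k| ≤ η} is thin and its measure is small uniformly in k (`exists_slab_measure_le`). -/

open Filter Topology

/-! ### Layers of a tanh network -/

open Classical in
/-- The coordinate functions of `ℝⁿ`. -/
noncomputable def coordFns (n : ℕ) : Finset (Eucl n → ℝ) :=
  Finset.univ.image fun (i : Fin n) (z : Eucl n) => z i

/-- The affine combinations of a finite family of functions. -/
noncomputable def affSpan {n : ℕ} (S : Finset (Eucl n → ℝ)) : Submodule ℝ (Eucl n → ℝ) :=
  Submodule.span ℝ (insert 1 (S : Set (Eucl n → ℝ)))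

/-- `S` consists of functions computed by neurons in the `L`-th hidden layer of a tanh network all
of whose hidden layers have width at most `W`; the layer `0` is the input. -/
def IsLayer {n : ℕ} (W : ℕ) : ℕ → Finset (Eucl n → ℝ) → Prop
  | 0, S => S = coordFns n
  | L + 1, S => S.card ≤ W ∧ ∃ S₀, IsLayer W L S₀ ∧
      ∀ g ∈ S, ∃ h ∈ affSpan S₀, g = fun z => Real.tanh (h z)

/-- `h` is computed by a tanh network with `L` hidden layers of width at most `W`. -/
def Realizes {n : ℕ} (L W : ℕ) (h : Eucl n → ℝ) : Prop :=
  ∃ S, IsLayer W L S ∧ h ∈ affSpan S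

section Networks

variable {n : ℕ}

theorem affSpan_mono {S S' : Finset (Eucl n → ℝ)} (h : S ⊆ S') : affSpan S ≤ affSpan S' :=
  Submodule.span_mono (insert_subset_insert (by exact_mod_cast h))

theorem const_mem_affSpan (S : Finset (Eucl n → ℝ)) (b : ℝ) : (fun _ => b) ∈ affSpan S := by
  have : (fun _ => b : Eucl n → ℝ) = b • (1 : Eucl n → ℝ) := by ext; simp
  rw [this]
  exact Submodule.smul_mem _ _ (Submodule.subset_span (mem_insert _ _))

theorem mem_affSpan {S : Finset (Eucl n → ℝ)} {h : Eucl n → ℝ} (hh : h ∈ S) : h ∈ affSpan S :=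
  Submodule.subset_span (mem_insert_of_mem _ (by exact_mod_cast hh))

theorem affSpan_eq_comb {S : Finset (Eucl n → ℝ)} {m : ℕ} {F : Fin m → Eucl n → ℝ}
    (hF : ∀ g ∈ S, ∃ j, F j = g) {h : Eucl n → ℝ} (hh : h ∈ affSpan S) :
    ∃ (w : Fin m → ℝ) (b : ℝ), ∀ z, h z = (∑ j, w j * F j z) + b := by
  induction hh using Submodule.span_induction with
  | mem g hg =>
    rcases hg with rfl | hg
    · exact ⟨0, 1, fun z => by simp⟩
    · obtain ⟨j, rfl⟩ := hF g (by exact_mod_cast hg)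
      refine ⟨Pi.single j 1, 0, fun z => ?_⟩
      simp [Pi.single_apply]
  | zero => exact ⟨0, 0, fun z => by simp⟩
  | add f g _ _ hf hg =>
    obtain ⟨w, b, h₁⟩ := hf
    obtain ⟨w', b', h₂⟩ := hg
    refine ⟨w + w', b + b', fun z => ?_⟩
    simp only [Pi.add_apply, h₁, h₂, add_mul, Finset.sum_add_distrib]
    ring
  | smul a f _ hf =>
    obtain ⟨w, b, h₁⟩ := hf
    refine ⟨a • w, a * b, fun z => ?_⟩
    simp only [Pi.smul_apply, h₁, smul_eq_mul, mul_add, Finset.mul_sum, mul_assoc]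

theorem IsLayer.mono {W W' : ℕ} (hW : W ≤ W') : ∀ {L : ℕ} {S : Finset (Eucl n → ℝ)},
    IsLayer W L S → IsLayer W' L S
  | 0, _, h => h
  | _ + 1, _, ⟨hc, S₀, h₀, h⟩ => ⟨hc.trans hW, S₀, h₀.mono hW, h⟩

open Classical in
-- Two networks of equal depth run side by side. Both read the full input, so layer 0 is shared and
-- adds no width.
theorem IsLayer.union {W W' : ℕ} : ∀ {L : ℕ} {S S' : Finset (Eucl n → ℝ)},
    IsLayer W L S → IsLayer W' L S' → IsLayer (W + W') L (S ∪ S')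
  | 0, S, S', h, h' => by
    simp only [IsLayer] at h h' ⊢
    rw [h, h', Finset.union_self]
  | L + 1, S, S', ⟨hc, S₀, h₀, h⟩, ⟨hc', S₀', h₀', h'⟩ => by
    refine ⟨(Finset.card_union_le _ _).trans (add_le_add hc hc'), S₀ ∪ S₀', h₀.union h₀', ?_⟩
    intro g hg
    rcases Finset.mem_union.1 hg with hg | hg
    · obtain ⟨k, hk, rfl⟩ := h g hg
      exact ⟨k, affSpan_mono Finset.subset_union_left hk, rfl⟩
    · obtain ⟨k, hk, rfl⟩ := h' g hg
      exact ⟨k, affSpan_mono Finset.subset_union_right hk, rfl⟩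

/-- Empty hidden layers still carry constants; this supplies the zero network of any depth, the
neutral element for sums. -/
theorem exists_isLayer_zero_width : ∀ L : ℕ, ∃ S : Finset (Eucl n → ℝ), IsLayer 0 L S
  | 0 => ⟨coordFns n, rfl⟩
  | L + 1 => by
    obtain ⟨S₀, h₀⟩ := exists_isLayer_zero_width L
    exact ⟨∅, by simp, S₀, h₀, by simp⟩

open Classical in
-- `IsLayer` grows at the output end while `NetParams` grows at the input end. Quantifying over the
-- remaining network `rest` reconciles the two: the induction step prepends its layer to `rest`.
theorem IsLayer.exists_netParams {W : ℕ} : ∀ {L : ℕ} {S : Finset (Eucl n → ℝ)}, IsLayer W L S →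
    ∃ (m : ℕ) (F : Fin m → Eucl n → ℝ), (L = 0 ∨ m ≤ W) ∧ (∀ g ∈ S, ∃ j, F j = g) ∧
      ∀ rest : NetParams m, ∃ θ : NetParams n, θ.depth = rest.depth + L ∧
        θ.width ≤ max W rest.width ∧
        ∀ z : Eucl n, θ.raw (fun i => z i) = rest.raw fun j => F j z
  | 0, S, h => by
    refine ⟨n, fun i z => z i, Or.inl rfl, ?_, fun rest => ⟨rest, rfl, le_max_right _ _,
      fun z => rfl⟩⟩
    intro g hg
    rw [show S = coordFns n from h, coordFns, Finset.mem_image] at hg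
    obtain ⟨i, -, rfl⟩ := hg
    exact ⟨i, rfl⟩
  | L + 1, S, ⟨hc, S₀, h₀, h⟩ => by
    obtain ⟨m, F, hm, hF, hθ⟩ := h₀.exists_netParams
    refine ⟨S.card, fun j => (S.equivFin.symm j).1, Or.inr hc,
      fun g hg => ⟨S.equivFin ⟨g, hg⟩, by simp⟩, fun rest => ?_⟩
    have key : ∀ j : Fin S.card, ∃ (w : Fin m → ℝ) (b : ℝ),
        ∀ z, (S.equivFin.symm j).1 z = Real.tanh ((∑ i, w i * F i z) + b) := by
      intro j
      obtain ⟨k, hk, hkj⟩ := h _ (S.equivFin.symm j).2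
      obtain ⟨w, b, hwb⟩ := affSpan_eq_comb hF hk
      exact ⟨w, b, fun z => by rw [hkj]; simp only [hwb]⟩
    choose w b hwb using key
    obtain ⟨θ, h₁, h₂, h₃⟩ := hθ (NetParams.hidden (Matrix.of w) b rest)
    refine ⟨θ, ?_, ?_, fun z => ?_⟩
    · rw [h₁, NetParams.depth]; ring
    · refine h₂.trans ?_
      rw [NetParams.width]
      exact max_le (le_max_left _ _) (max_le_max_right _ hc)
    · rw [h₃, NetParams.raw]
      congr 1
      ext j
      exact (hwb j z).symm

theorem Realizes.exists_netParams {L W : ℕ} {h : Eucl n → ℝ} (hh : Realizes L W h) :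
    ∃ θ : NetParams n, θ.depth = L + 1 ∧ θ.width ≤ W ∧
      ∀ z : Eucl n, θ.raw (fun i => z i) = h z := by
  obtain ⟨S, hS, hhS⟩ := hh
  obtain ⟨m, F, -, hF, hθ⟩ := hS.exists_netParams
  obtain ⟨w, b, hwb⟩ := affSpan_eq_comb hF hhS
  obtain ⟨θ, h₁, h₂, h₃⟩ := hθ (NetParams.out w b)
  refine ⟨θ, ?_, ?_, fun z => ?_⟩
  · rw [h₁, NetParams.depth]; ring
  · simpa [NetParams.width] using h₂
  · rw [h₃, NetParams.raw, hwb]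

theorem Realizes.mono {L W W' : ℕ} (hW : W ≤ W') {h : Eucl n → ℝ} (hh : Realizes L W h) :
    Realizes L W' h :=
  let ⟨S, hS, hhS⟩ := hh
  ⟨S, hS.mono hW, hhS⟩

theorem Realizes.zero (L : ℕ) : Realizes L 0 (0 : Eucl n → ℝ) :=
  let ⟨S, hS⟩ := exists_isLayer_zero_width L
  ⟨S, hS, Submodule.zero_mem _⟩

theorem Realizes.add {L W W' : ℕ} {h h' : Eucl n → ℝ} (hh : Realizes L W h)
    (hh' : Realizes L W' h') : Realizes L (W + W') (h + h') := by
  classical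
  obtain ⟨S, hS, hhS⟩ := hh
  obtain ⟨S', hS', hhS'⟩ := hh'
  exact ⟨S ∪ S', hS.union hS', Submodule.add_mem _ (affSpan_mono Finset.subset_union_left hhS)
    (affSpan_mono Finset.subset_union_right hhS')⟩

theorem Realizes.smul {L W : ℕ} {h : Eucl n → ℝ} (a : ℝ) (hh : Realizes L W h) :
    Realizes L W (a • h) :=
  let ⟨S, hS, hhS⟩ := hh
  ⟨S, hS, Submodule.smul_mem _ _ hhS⟩

end Networks

/-! ### Approximation of the rectifier -/

/-- A tanh network with two hidden layers of two and three neurons that tends to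
`max x 0` as `k → ∞`. -/
noncomputable def softRelu (k : ℕ) (x : ℝ) : ℝ :=
  ((k + 1 : ℝ) / Real.tanh 1 ^ 2) *
    (Real.tanh (Real.tanh (x / (k + 1)))
      - Real.tanh (Real.tanh (x / (k + 1)) + (1 + Real.tanh ((k + 1) * x)) / 2)
      + Real.tanh ((1 + Real.tanh ((k + 1) * x)) / 2))

/-- One rectifier layer applied to a finite family `H` of functions on a common layer. -/
theorem IsLayer.softRelu {n : ℕ} {W L : ℕ} {S : Finset (Eucl n → ℝ)} (hS : IsLayer W L S) (k : ℕ)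
    (H : Finset (Eucl n → ℝ)) (hH : ∀ h ∈ H, h ∈ affSpan S) :
    ∃ S', IsLayer (max W (3 * H.card)) (L + 2) S' ∧
      ∀ h ∈ H, (fun z => softRelu k (h z)) ∈ affSpan S' := by
  classical
  set t : (Eucl n → ℝ) → Eucl n → ℝ := fun h z => Real.tanh (h z / (k + 1))
  set s : (Eucl n → ℝ) → Eucl n → ℝ := fun h z => Real.tanh ((k + 1) * h z)
  set a : (Eucl n → ℝ) → Eucl n → ℝ := fun h z => Real.tanh (t h z)
  set b : (Eucl n → ℝ) → Eucl n → ℝ := fun h z => Real.tanh (t h z + (1 + s h z) / 2)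
  set c : (Eucl n → ℝ) → Eucl n → ℝ := fun h z => Real.tanh ((1 + s h z) / 2)
  set S₁ : Finset (Eucl n → ℝ) := H.image t ∪ H.image s
  set S₂ : Finset (Eucl n → ℝ) := H.image a ∪ H.image b ∪ H.image c
  have ht : ∀ h ∈ H, t h ∈ affSpan S₁ := fun h hh =>
    mem_affSpan (Finset.mem_union_left _ (Finset.mem_image_of_mem _ hh))
  have hs : ∀ h ∈ H, (fun z => (1 + s h z) / 2) ∈ affSpan S₁ := fun h hh => by
    have h₁ : s h ∈ affSpan S₁ :=
      mem_affSpan (Finset.mem_union_right _ (Finset.mem_image_of_mem _ hh))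
    have h₂ := Submodule.add_mem _ (const_mem_affSpan S₁ (1 / 2))
      (Submodule.smul_mem _ (1 / 2 : ℝ) h₁)
    convert h₂ using 1
    ext z
    simp
    ring
  have c₁ : S₁.card ≤ max W (3 * H.card) := by
    refine (Finset.card_union_le _ _).trans (le_trans ?_ (le_max_right _ _))
    have h₁ := Finset.card_image_le (s := H) (f := t)
    have h₂ := Finset.card_image_le (s := H) (f := s)
    omega
  have c₂ : S₂.card ≤ max W (3 * H.card) := by
    refine (Finset.card_union_le _ _).trans (le_trans ?_ (le_max_right _ _))
    have h₀ := Finset.card_union_le (H.image a) (H.image b)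
    have h₁ := Finset.card_image_le (s := H) (f := a)
    have h₂ := Finset.card_image_le (s := H) (f := b)
    have h₃ := Finset.card_image_le (s := H) (f := c)
    omega
  refine ⟨S₂, ⟨c₂, S₁, ⟨c₁, S, hS.mono (le_max_left _ _), ?_⟩, ?_⟩, ?_⟩
  · intro g hg
    rcases Finset.mem_union.1 hg with hg | hg <;> obtain ⟨h, hh, rfl⟩ := Finset.mem_image.1 hg
    · refine ⟨_, Submodule.smul_mem _ ((k + 1 : ℝ)⁻¹) (hH h hh), ?_⟩
      ext z
      simp [t, div_eq_inv_mul]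
    · exact ⟨_, Submodule.smul_mem _ (k + 1 : ℝ) (hH h hh), rfl⟩
  · intro g hg
    rcases Finset.mem_union.1 hg with hg | hg
    · rcases Finset.mem_union.1 hg with hg | hg <;> obtain ⟨h, hh, rfl⟩ := Finset.mem_image.1 hg
      · exact ⟨_, ht h hh, rfl⟩
      · exact ⟨_, Submodule.add_mem _ (ht h hh) (hs h hh), rfl⟩
    · obtain ⟨h, hh, rfl⟩ := Finset.mem_image.1 hg
      exact ⟨_, hs h hh, rfl⟩
  · intro h hh
    have h₁ : a h ∈ affSpan S₂ := mem_affSpan (Finset.mem_union_left _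
      (Finset.mem_union_left _ (Finset.mem_image_of_mem _ hh)))
    have h₂ : b h ∈ affSpan S₂ := mem_affSpan (Finset.mem_union_left _
      (Finset.mem_union_right _ (Finset.mem_image_of_mem _ hh)))
    have h₃ : c h ∈ affSpan S₂ :=
      mem_affSpan (Finset.mem_union_right _ (Finset.mem_image_of_mem _ hh))
    exact Submodule.smul_mem _ ((k + 1 : ℝ) / Real.tanh 1 ^ 2)
      (Submodule.add_mem _ (Submodule.sub_mem _ h₁ h₂) h₃)

/-! ### Elementary properties of tanh -/

theorem hasDerivAt_tanh (x : ℝ) : HasDerivAt Real.tanh (1 - Real.tanh x ^ 2) x := by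
  have h := (Real.hasDerivAt_sinh x).div (Real.hasDerivAt_cosh x) (Real.cosh_pos x).ne'
  have e : Real.tanh = Real.sinh / Real.cosh := by
    ext y; rw [Real.tanh_eq_sinh_div_cosh]; rfl
  rw [e]
  refine h.congr_deriv ?_
  have := (Real.cosh_pos x).ne'
  rw [Pi.div_apply]
  field_simp

theorem continuous_tanh : Continuous Real.tanh :=
  continuous_iff_continuousAt.2 fun x => (hasDerivAt_tanh x).continuousAt

theorem one_sub_tanh_sq_mem (x : ℝ) : 0 ≤ 1 - Real.tanh x ^ 2 ∧ 1 - Real.tanh x ^ 2 ≤ 1 :=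
  ⟨by linarith [Real.tanh_sq_lt_one x], by linarith [sq_nonneg (Real.tanh x)]⟩

theorem abs_tanh_le (x : ℝ) : |Real.tanh x| ≤ |x| := by
  have h : LipschitzWith 1 Real.tanh := by
    refine lipschitzWith_of_nnnorm_deriv_le (fun y => (hasDerivAt_tanh y).differentiableAt) ?_
    intro y
    rw [(hasDerivAt_tanh y).deriv, ← NNReal.coe_le_coe]
    have := one_sub_tanh_sq_mem y
    simp only [coe_nnnorm, Real.norm_eq_abs, NNReal.coe_one, abs_of_nonneg this.1]
    exact this.2
  simpa using h.dist_le_mul x 0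

/-- The derivative of tanh is 1/cosh², and |x| ≤ sinh |x| < cosh x. This decay controls the
derivative of the gate tanh((k+1)x). -/
theorem sq_mul_one_sub_tanh_sq_le (x : ℝ) : x ^ 2 * (1 - Real.tanh x ^ 2) ≤ 1 := by
  have hc := Real.cosh_pos x
  have h₁ : 1 - Real.tanh x ^ 2 = (Real.cosh x ^ 2)⁻¹ := by
    rw [Real.tanh_eq_sinh_div_cosh, div_pow]
    have := Real.cosh_sq x
    field_simp
    linarith
  have h₂ : x ^ 2 ≤ Real.cosh x ^ 2 := by
    have h₃ : |x| ≤ Real.sinh |x| := Real.self_le_sinh_iff.2 (abs_nonneg x)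
    have h₄ := Real.sinh_lt_cosh |x|
    rw [Real.cosh_abs] at h₄
    rw [← sq_abs x]
    exact pow_le_pow_left₀ (abs_nonneg x) (h₃.trans h₄.le) 2
  rw [h₁, ← div_eq_mul_inv]
  exact (div_le_one (by positivity)).2 h₂

theorem abs_mul_one_sub_tanh_sq_le (x : ℝ) : |x| * (1 - Real.tanh x ^ 2) ≤ 1 := by
  have h := one_sub_tanh_sq_mem x
  rcases le_total |x| 1 with hx | hx
  · exact mul_le_one₀ hx h.1 h.2
  · refine le_trans ?_ (sq_mul_one_sub_tanh_sq_le x)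
    rw [← sq_abs x]
    exact mul_le_mul_of_nonneg_right (by nlinarith) h.1

theorem tendsto_tanh_atTop : Tendsto Real.tanh atTop (𝓝 1) := by
  have h : Tendsto (fun x => 1 - Real.tanh x ^ 2) atTop (𝓝 0) := by
    refine squeeze_zero' (Eventually.of_forall fun x => (one_sub_tanh_sq_mem x).1) ?_
      (tendsto_inv_atTop_zero.comp (tendsto_pow_atTop (two_ne_zero)))
    filter_upwards [eventually_gt_atTop 0] with x hx
    have := sq_mul_one_sub_tanh_sq_le x
    simp only [Function.comp]
    rw [← one_div, le_div_iff₀ (by positivity)]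
    linarith
  have h₂ := (tendsto_const_nhds (x := (1 : ℝ))).sub h
  simp only [sub_sub_cancel, sub_zero] at h₂
  have h₃ := h₂.sqrt
  rw [Real.sqrt_one] at h₃
  refine h₃.congr' ?_
  filter_upwards [eventually_ge_atTop 0] with x hx
  refine Real.sqrt_sq ?_
  rw [Real.tanh_eq_sinh_div_cosh]
  exact div_nonneg (Real.sinh_nonneg_iff.2 hx) (Real.cosh_pos x).le

theorem tendsto_tanh_atBot : Tendsto Real.tanh atBot (𝓝 (-1)) := by
  have := (tendsto_tanh_atTop.comp tendsto_neg_atBot_atTop).neg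
  refine this.congr fun x => ?_
  simp

theorem tanh_pos_of_pos {x : ℝ} (hx : 0 < x) : 0 < Real.tanh x := by
  rw [Real.tanh_eq_sinh_div_cosh]
  exact div_pos (Real.sinh_pos_iff.2 hx) (Real.cosh_pos x)

/-- Turns a product into a sum of neurons. In `softRelu`, a ≈ x/(k+1) and b is a gate near 0 or 1:
an open gate contributes the two factors tanh b and tanh(a+b), each close to tanh 1, whence the
normalization by tanh² 1; a closed gate makes the product small. -/
theorem tanh_add_tanh_sub_tanh_add (a b : ℝ) :
    Real.tanh a - Real.tanh (a + b) + Real.tanh b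
      = Real.tanh a * Real.tanh b * Real.tanh (a + b) := by
  have ha := (Real.cosh_pos a).ne'
  have hb := (Real.cosh_pos b).ne'
  have hab := (Real.cosh_pos (a + b)).ne'
  simp only [Real.tanh_eq_sinh_div_cosh]
  field_simp
  rw [Real.sinh_add, Real.cosh_add]
  ring_nf

/-- `k tanh (y_k / k) → y` as `y_k → y`. -/
theorem tendsto_mul_tanh_div {y : ℕ → ℝ} {a : ℝ} (hy : Tendsto y atTop (𝓝 a)) :
    Tendsto (fun k : ℕ => (k + 1 : ℝ) * Real.tanh (y k / (k + 1))) atTop (𝓝 a) := by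
  have hk : Tendsto (fun k : ℕ => (k + 1 : ℝ)) atTop atTop :=
    tendsto_natCast_atTop_atTop.atTop_add tendsto_const_nhds
  have hu : Tendsto (fun k : ℕ => y k / (k + 1)) atTop (𝓝 0) := hy.div_atTop hk
  have h₀ : (fun u : ℝ => Real.tanh u - u) =o[𝓝 0] fun u => u := by
    have := (hasDerivAt_tanh 0).isLittleO
    simpa using this
  have h₁ := h₀.comp_tendsto hu
  have h₂ := (Asymptotics.isBigO_refl (fun k : ℕ => (k + 1 : ℝ)) atTop).mul_isLittleO h₁
  have h₃ : (fun k : ℕ => (k + 1 : ℝ) * (Real.tanh (y k / (k + 1)) - y k / (k + 1)))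
      =o[atTop] fun _ => (1 : ℝ) := by
    refine h₂.trans_isBigO ?_
    refine Asymptotics.IsBigO.congr_left (hy.isBigO_one ℝ) fun k => ?_
    have : (k + 1 : ℝ) ≠ 0 := by positivity
    simp only [Function.comp]
    field_simp
  have h₄ := ((Asymptotics.isLittleO_one_iff ℝ).1 h₃).add hy
  rw [zero_add] at h₄
  refine h₄.congr fun k => ?_
  have : (k + 1 : ℝ) ≠ 0 := by positivity
  field_simp
  ring

theorem softRelu_eq (k : ℕ) (x : ℝ) : softRelu k x = ((k + 1 : ℝ) / Real.tanh 1 ^ 2) *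
    (Real.tanh (Real.tanh (x / (k + 1))) * Real.tanh ((1 + Real.tanh ((k + 1) * x)) / 2) *
      Real.tanh (Real.tanh (x / (k + 1)) + (1 + Real.tanh ((k + 1) * x)) / 2)) := by
  rw [softRelu, tanh_add_tanh_sub_tanh_add]

theorem softRelu_zero (k : ℕ) : softRelu k 0 = 0 := by simp [softRelu_eq]

/-- The derivative of `softRelu k`, in a form in which each term is bounded. -/
noncomputable def softReluDeriv (k : ℕ) (x : ℝ) : ℝ :=
  let t := Real.tanh (x / (k + 1))
  let s := Real.tanh ((k + 1) * x)
  let P := Real.tanh t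
  let Q := Real.tanh ((1 + s) / 2)
  let R := Real.tanh (t + (1 + s) / 2)
  ((1 - P ^ 2) * (1 - t ^ 2) * Q * R
    + ((k + 1) * P) * ((k + 1) * (1 - s ^ 2) / 2) * (1 - Q ^ 2) * R
    + P * (1 - t ^ 2) * Q * (1 - R ^ 2)
    + ((k + 1) * P) * ((k + 1) * (1 - s ^ 2) / 2) * Q * (1 - R ^ 2)) / Real.tanh 1 ^ 2

theorem hasDerivAt_softRelu (k : ℕ) (x : ℝ) : HasDerivAt (softRelu k) (softReluDeriv k x) x := by
  have hk : (k + 1 : ℝ) ≠ 0 := by positivity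
  have ht : HasDerivAt (fun x : ℝ => Real.tanh (x / (k + 1)))
      ((1 - Real.tanh (x / (k + 1)) ^ 2) * (1 / (k + 1))) x :=
    (hasDerivAt_tanh _).comp x ((hasDerivAt_id x).div_const _)
  have hs : HasDerivAt (fun x : ℝ => (1 + Real.tanh ((k + 1) * x)) / 2)
      ((1 - Real.tanh ((k + 1) * x) ^ 2) * ((k + 1) * 1) / 2) x :=
    (((hasDerivAt_tanh _).comp x ((hasDerivAt_id x).const_mul (k + 1 : ℝ))).const_add 1).div_const 2
  have hP := (hasDerivAt_tanh _).comp x ht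
  have hQ := (hasDerivAt_tanh _).comp x hs
  have hR := (hasDerivAt_tanh _).comp x (ht.add hs)
  have h := ((hP.mul hQ).mul hR).const_mul ((k + 1 : ℝ) / Real.tanh 1 ^ 2)
  have e : softRelu k = fun x => ((k + 1 : ℝ) / Real.tanh 1 ^ 2) *
    (Real.tanh (Real.tanh (x / (k + 1))) * Real.tanh ((1 + Real.tanh ((k + 1) * x)) / 2) *
      Real.tanh (Real.tanh (x / (k + 1)) + (1 + Real.tanh ((k + 1) * x)) / 2)) :=
    funext (softRelu_eq k)
  rw [e]
  refine h.congr_deriv ?_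
  have h₁ : Real.tanh 1 ≠ 0 := (tanh_pos_of_pos one_pos).ne'
  simp only [softReluDeriv, Function.comp_apply, Pi.mul_apply, Pi.add_apply]
  field_simp
  ring

theorem abs_mul_tanh_tanh_div_le (k : ℕ) (x : ℝ) :
    |(k + 1 : ℝ) * Real.tanh (Real.tanh (x / (k + 1)))| ≤ |x| := by
  have hk : (0 : ℝ) < k + 1 := by positivity
  rw [abs_mul, abs_of_pos hk]
  calc _ ≤ (k + 1 : ℝ) * |x / (k + 1)| := by
        exact mul_le_mul_of_nonneg_left ((abs_tanh_le _).trans (abs_tanh_le _)) hk.le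
    _ = |x| := by rw [abs_div, abs_of_pos hk]; field_simp

/-- Bounds the derivative independently of k. Two of the four terms contain the derivative of the
gate, which is of order k near 0, but there they also contain a factor that vanishes at 0. The four
terms are bounded by 1, 1/2, 1 and 1/2. -/
theorem abs_softReluDeriv_le (k : ℕ) (x : ℝ) : |softReluDeriv k x| ≤ 3 / Real.tanh 1 ^ 2 := by
  have hτ : 0 < Real.tanh 1 ^ 2 := pow_pos (tanh_pos_of_pos one_pos) 2
  rw [softReluDeriv, abs_div, abs_of_pos hτ]
  gcongr
  set t := Real.tanh (x / (k + 1))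
  set s := Real.tanh ((k + 1) * x) with hs
  set P := Real.tanh t with hP
  set Q := Real.tanh ((1 + s) / 2)
  set R := Real.tanh (t + (1 + s) / 2)
  have ht1 := one_sub_tanh_sq_mem (x / (k + 1))
  have hP1 := one_sub_tanh_sq_mem t
  have hQ1 := one_sub_tanh_sq_mem ((1 + s) / 2)
  have hR1 := one_sub_tanh_sq_mem (t + (1 + s) / 2)
  have aP : |P| ≤ 1 := (Real.abs_tanh_lt_one _).le
  have aQ : |Q| ≤ 1 := (Real.abs_tanh_lt_one _).le
  have aR : |R| ≤ 1 := (Real.abs_tanh_lt_one _).le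
  have a1 : |1 - P ^ 2| ≤ 1 := by rw [abs_of_nonneg hP1.1]; exact hP1.2
  have a2 : |1 - t ^ 2| ≤ 1 := by rw [abs_of_nonneg ht1.1]; exact ht1.2
  have a3 : |1 - Q ^ 2| ≤ 1 := by rw [abs_of_nonneg hQ1.1]; exact hQ1.2
  have a4 : |1 - R ^ 2| ≤ 1 := by rw [abs_of_nonneg hR1.1]; exact hR1.2
  -- One factor is at most |x| and the other is (k+1)(1 − tanh² y)/2 with y = (k+1)x, so the product
  -- is at most |y|(1 − tanh² y)/2.
  have hm : |((k + 1 : ℝ) * P) * ((k + 1) * (1 - s ^ 2) / 2)| ≤ 1 / 2 := by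
    have hk : (0 : ℝ) < k + 1 := by positivity
    have h₁ := abs_mul_tanh_tanh_div_le k x
    have h₂ := abs_mul_one_sub_tanh_sq_le ((k + 1) * x)
    have h₃ := one_sub_tanh_sq_mem ((k + 1) * x)
    rw [← hs] at h₂ h₃
    rw [abs_mul, abs_of_nonneg (a := (k + 1 : ℝ) * (1 - s ^ 2) / 2)
      (by have := h₃.1; positivity)]
    calc _ ≤ |x| * ((k + 1) * (1 - s ^ 2) / 2) := by
          gcongr
          have := h₃.1; positivity
      _ = |(k + 1) * x| * (1 - s ^ 2) / 2 := by rw [abs_mul, abs_of_pos hk]; ring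
      _ ≤ 1 / 2 := by linarith
  have m2 : ∀ {a b A : ℝ}, |a| ≤ A → |b| ≤ 1 → |a * b| ≤ A := by
    intro a b A ha hb
    rw [abs_mul]
    nlinarith [abs_nonneg a, abs_nonneg b]
  have b1 := m2 (m2 (m2 a1 a2) aQ) aR
  have b2 := m2 (m2 hm a3) aR
  have b3 := m2 (m2 (m2 aP a2) aQ) a4
  have b4 := m2 (m2 hm aQ) a4
  refine (abs_add_le _ _).trans ?_
  refine (add_le_add_left ((abs_add_le _ _).trans (add_le_add_left (abs_add_le _ _) _)) _).trans ?_
  linarith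

theorem lipschitzWith_softRelu (k : ℕ) :
    LipschitzWith (3 / Real.tanh 1 ^ 2).toNNReal (softRelu k) := by
  refine lipschitzWith_of_nnnorm_deriv_le
    (fun y => (hasDerivAt_softRelu k y).differentiableAt) fun y => ?_
  rw [(hasDerivAt_softRelu k y).deriv, ← NNReal.coe_le_coe, Real.coe_toNNReal _ (by positivity)]
  exact abs_softReluDeriv_le k y

/-- The argument varies with k because in a deep network it is itself an approximation. At a = 0 the
values converge by the uniform Lipschitz bound, while the derivatives may oscillate. -/
theorem tendsto_softRelu {x : ℕ → ℝ} {a : ℝ} (hx : Tendsto x atTop (𝓝 a)) :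
    Tendsto (fun k => softRelu k (x k)) atTop (𝓝 (max a 0)) ∧
    (a ≠ 0 → Tendsto (fun k => softReluDeriv k (x k)) atTop (𝓝 (if 0 < a then 1 else 0))) := by
  rcases eq_or_ne a 0 with rfl | ha
  · refine ⟨?_, fun h => absurd rfl h⟩
    rw [max_self]
    have h₁ : Tendsto (fun k => (3 / Real.tanh 1 ^ 2) * |x k|) atTop (𝓝 0) := by
      simpa using (hx.abs.const_mul (3 / Real.tanh 1 ^ 2))
    refine squeeze_zero_norm (fun k => ?_) h₁
    have := (lipschitzWith_softRelu k).dist_le_mul (x k) 0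
    rwa [softRelu_zero, dist_zero_right, dist_zero_right, Real.coe_toNNReal _ (by positivity)]
      at this
  have hk : Tendsto (fun k : ℕ => (k + 1 : ℝ)) atTop atTop :=
    tendsto_natCast_atTop_atTop.atTop_add tendsto_const_nhds
  have hτ : Real.tanh 1 ≠ 0 := (tanh_pos_of_pos one_pos).ne'
  set t : ℕ → ℝ := fun k => Real.tanh (x k / (k + 1))
  set s : ℕ → ℝ := fun k => Real.tanh ((k + 1) * x k)
  set σ : ℝ := if 0 < a then 1 else 0
  have ht : Tendsto t atTop (𝓝 0) := by
    have := (continuous_tanh.tendsto 0).comp (hx.div_atTop hk)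
    rwa [Real.tanh_zero] at this
  have hB : Tendsto (fun k => (1 + s k) / 2) atTop (𝓝 σ) := by
    rcases lt_or_gt_of_ne ha with h | h
    · have h₁ : Tendsto s atTop (𝓝 (-1)) := tendsto_tanh_atBot.comp (hk.atTop_mul_neg h hx)
      have h₂ := (h₁.const_add 1).div_const 2
      simpa [σ, not_lt.2 h.le] using h₂
    · have h₁ : Tendsto s atTop (𝓝 1) := tendsto_tanh_atTop.comp (hk.atTop_mul_pos h hx)
      have h₂ := (h₁.const_add 1).div_const 2
      simpa [σ, h, one_add_one_eq_two] using h₂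
  have hP : Tendsto (fun k => Real.tanh (t k)) atTop (𝓝 0) := by
    have := (continuous_tanh.tendsto 0).comp ht
    rwa [Real.tanh_zero] at this
  have hkP : Tendsto (fun k : ℕ => (k + 1 : ℝ) * Real.tanh (t k)) atTop (𝓝 a) := by
    -- Applied twice, once for each of the nested tanh.
    have h := tendsto_mul_tanh_div (tendsto_mul_tanh_div hx)
    refine h.congr fun k => ?_
    have : (k + 1 : ℝ) ≠ 0 := by positivity
    simp only [t]
    rw [mul_div_cancel_left₀ _ this]
  have hQ : Tendsto (fun k => Real.tanh ((1 + s k) / 2)) atTop (𝓝 (Real.tanh σ)) :=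
    (continuous_tanh.tendsto σ).comp hB
  have hR : Tendsto (fun k => Real.tanh (t k + (1 + s k) / 2)) atTop (𝓝 (Real.tanh σ)) := by
    have := (continuous_tanh.tendsto _).comp (ht.add hB)
    rwa [zero_add] at this
  have hσ : Real.tanh σ * Real.tanh σ = σ * Real.tanh 1 ^ 2 := by
    simp only [σ]; split_ifs <;> simp [sq]
  -- The gate derivative is at most 1/(2(k+1)x_k²), by the quadratic decay of tanh', and x_k stays
  -- away from 0.
  have hS : Tendsto (fun k : ℕ => (k + 1 : ℝ) * (1 - s k ^ 2) / 2) atTop (𝓝 0) := by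
    have h₁ : Tendsto (fun k : ℕ => (2 * x k ^ 2 * (k + 1 : ℝ))⁻¹) atTop (𝓝 0) :=
      tendsto_inv_atTop_zero.comp (Tendsto.pos_mul_atTop (by positivity)
        ((hx.pow 2).const_mul 2) hk)
    refine squeeze_zero' (Eventually.of_forall fun k => ?_) ?_ h₁
    · have := (one_sub_tanh_sq_mem ((k + 1) * x k)).1
      have h₂ : (0 : ℝ) ≤ 1 - s k ^ 2 := this
      positivity
    · filter_upwards [hx.eventually_ne ha] with k hxk
      have h₂ := sq_mul_one_sub_tanh_sq_le ((k + 1) * x k)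
      have hk' : (0 : ℝ) < k + 1 := by positivity
      rw [← one_div, le_div_iff₀ (by positivity)]
      calc _ = ((k + 1) * x k) ^ 2 * (1 - s k ^ 2) := by ring
        _ ≤ 1 := h₂
  refine ⟨?_, fun _ => ?_⟩
  · have h := ((hkP.mul hQ).mul hR).const_mul (1 / Real.tanh 1 ^ 2)
    have e : 1 / Real.tanh 1 ^ 2 * (a * Real.tanh σ * Real.tanh σ) = max a 0 := by
      rw [mul_assoc a, hσ]
      simp only [σ]
      split_ifs with h0
      · rw [max_eq_left h0.le]; field_simp
      · rw [max_eq_right (not_lt.1 h0)]; simp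
    rw [e] at h
    refine h.congr fun k => ?_
    rw [softRelu_eq]
    simp only [t, s]
    ring
  · have one {u : ℕ → ℝ} {c : ℝ} (hu : Tendsto u atTop (𝓝 c)) :
        Tendsto (fun k => 1 - u k ^ 2) atTop (𝓝 (1 - c ^ 2)) := (hu.pow 2).const_sub 1
    have h := ((((((one hP).mul (one ht)).mul hQ).mul hR).add
      (((hkP.mul hS).mul (one hQ)).mul hR)).add
      (((hP.mul (one ht)).mul hQ).mul (one hR))).add (((hkP.mul hS).mul hQ).mul (one hR))
    have h' := h.div_const (Real.tanh 1 ^ 2)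
    have e : ((1 - 0 ^ 2) * (1 - 0 ^ 2) * Real.tanh σ * Real.tanh σ
          + a * 0 * (1 - Real.tanh σ ^ 2) * Real.tanh σ
          + 0 * (1 - 0 ^ 2) * Real.tanh σ * (1 - Real.tanh σ ^ 2)
          + a * 0 * Real.tanh σ * (1 - Real.tanh σ ^ 2)) / Real.tanh 1 ^ 2 = σ := by
      rw [div_eq_iff (pow_ne_zero 2 hτ), ← hσ]
      ring
    rw [e] at h'
    exact h'

/-! ### Limits of networks with almost everywhere convergent gradients -/

/-- The functions `h k` are differentiable, equi-Lipschitz and tend pointwise to the function `g`,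
which is locally affine almost everywhere, with finitely many affine pieces; there the derivatives
converge as well. -/
structure AELimit {n : ℕ} (h : ℕ → Eucl n → ℝ) (g : Eucl n → ℝ) : Prop where
  differentiable : ∀ k, Differentiable ℝ (h k)
  lipschitz : ∃ B : ℝ≥0, ∀ k, LipschitzWith B (h k)
  tendsto : ∀ z, Tendsto (fun k => h k z) atTop (𝓝 (g z))
  fderiv_tendsto : ∃ 𝒜 : Set ((Eucl n →L[ℝ] ℝ) × ℝ), 𝒜.Finite ∧ ∀ᵐ z, ∃ p ∈ 𝒜,
    (g =ᶠ[𝓝 z] fun y => p.1 y + p.2) ∧ Tendsto (fun k => fderiv ℝ (h k) z) atTop (𝓝 p.1)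

namespace AELimit

variable {n : ℕ} {h h' : ℕ → Eucl n → ℝ} {g g' : Eucl n → ℝ}

theorem affine (ℓ : Eucl n →L[ℝ] ℝ) (c : ℝ) :
    AELimit (fun _ z => ℓ z + c) (fun z => ℓ z + c) where
  differentiable _ := ℓ.differentiable.add_const c
  lipschitz := ⟨‖ℓ‖₊, fun _ => by simpa using ℓ.lipschitz.add (LipschitzWith.const c)⟩
  tendsto _ := tendsto_const_nhds
  fderiv_tendsto := ⟨{(ℓ, c)}, finite_singleton _, Eventually.of_forall fun z =>
    ⟨(ℓ, c), rfl, EventuallyEq.rfl, by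
      have : fderiv ℝ (fun z => ℓ z + c) z = ℓ := by
        rw [fderiv_add_const, ℓ.fderiv]
      simp only [this]
      exact tendsto_const_nhds⟩⟩

theorem zero : AELimit (fun _ => (0 : Eucl n → ℝ)) 0 := by
  have := affine (n := n) 0 0
  simp only [zero_apply, add_zero] at this
  exact this

theorem add (hg : AELimit h g) (hg' : AELimit h' g') :
    AELimit (fun k => h k + h' k) (g + g') where
  differentiable k := (hg.differentiable k).add (hg'.differentiable k)
  lipschitz := by
    obtain ⟨B, hB⟩ := hg.lipschitz
    obtain ⟨B', hB'⟩ := hg'.lipschitz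
    exact ⟨B + B', fun k => (hB k).add (hB' k)⟩
  tendsto z := (hg.tendsto z).add (hg'.tendsto z)
  fderiv_tendsto := by
    obtain ⟨A, hA, h₁⟩ := hg.fderiv_tendsto
    obtain ⟨A', hA', h₁'⟩ := hg'.fderiv_tendsto
    refine ⟨image2 (· + ·) A A', hA.image2 _ hA', ?_⟩
    filter_upwards [h₁, h₁'] with z ⟨p, hp, e, t⟩ ⟨p', hp', e', t'⟩
    refine ⟨p + p', ⟨p, hp, p', hp', rfl⟩, ?_, ?_⟩
    · filter_upwards [e, e'] with y hy hy'
      simp only [Pi.add_apply, hy, hy', Prod.fst_add, Prod.snd_add, add_apply]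
      ring
    · refine (t.add t').congr fun k => ?_
      exact (fderiv_add (hg.differentiable k z) (hg'.differentiable k z)).symm

theorem smul (a : ℝ) (hg : AELimit h g) : AELimit (fun k => a • h k) (a • g) where
  differentiable k := (hg.differentiable k).const_smul a
  lipschitz := by
    obtain ⟨B, hB⟩ := hg.lipschitz
    refine ⟨‖a‖₊ * B, fun k => LipschitzWith.of_dist_le_mul fun x y => ?_⟩
    have := (hB k).dist_le_mul x y
    simp only [Pi.smul_apply, dist_smul₀, NNReal.coe_mul, coe_nnnorm, mul_assoc]
    gcongr
  tendsto z := (hg.tendsto z).const_smul a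
  fderiv_tendsto := by
    obtain ⟨A, hA, h₁⟩ := hg.fderiv_tendsto
    refine ⟨(a • ·) '' A, hA.image _, ?_⟩
    filter_upwards [h₁] with z ⟨p, hp, e, t⟩
    refine ⟨a • p, ⟨p, hp, rfl⟩, ?_, ?_⟩
    · filter_upwards [e] with y hy
      simp only [Pi.smul_apply, hy, Prod.smul_fst, Prod.smul_snd, smul_eq_mul, mul_add,
        smul_apply]
    · refine (t.const_smul a).congr fun k => ?_
      exact (fderiv_const_smul (hg.differentiable k z) a).symm

theorem congr (hg : AELimit h g) (e : ∀ k z, h k z = h' k z) (e' : ∀ z, g z = g' z) :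
    AELimit h' g' := by
  have h₁ : h = h' := funext fun k => funext (e k)
  have h₂ : g = g' := funext e'
  rwa [← h₁, ← h₂]

theorem _root_.volume_affine_zero {p : (Eucl n →L[ℝ] ℝ) × ℝ} (hp : p ≠ 0) :
    volume {z : Eucl n | p.1 z + p.2 = 0} = 0 := by
  set A : Eucl n →ᵃ[ℝ] ℝ := p.1.toLinearMap.toAffineMap + AffineMap.const ℝ _ p.2
  set s : AffineSubspace ℝ (Eucl n) := (AffineSubspace.mk' (0 : ℝ) ⊥).comap A
  have hs : {z : Eucl n | p.1 z + p.2 = 0} = s := by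
    ext z
    simp [s, A]
  rw [hs]
  refine Measure.addHaar_affineSubspace _ _ fun htop => hp ?_
  have h₁ : ∀ z, p.1 z + p.2 = 0 := fun z => by
    have : z ∈ (s : Set (Eucl n)) := by rw [htop]; trivial
    rwa [← hs] at this
  have h₂ : p.2 = 0 := by simpa using h₁ 0
  refine Prod.ext (ContinuousLinearMap.ext fun z => ?_) h₂
  simpa [h₂] using h₁ z

/-- Finitely many affine pieces occur, so the zero sets of the nonzero ones form a null set. Off it,
a nonzero piece has a strict sign and the derivative of `softRelu` tends to 0 or 1. Where the piece
is identically zero that derivative need not converge, but it is bounded and multiplies gradients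
tending to 0. -/
theorem relu (hg : AELimit h g) :
    AELimit (fun k z => softRelu k (h k z)) (fun z => max (g z) 0) where
  differentiable k z :=
    (hasDerivAt_softRelu k _).differentiableAt.comp z (hg.differentiable k z)
  lipschitz := by
    obtain ⟨B, hB⟩ := hg.lipschitz
    exact ⟨_, fun k => (lipschitzWith_softRelu k).comp (hB k)⟩
  tendsto z := (tendsto_softRelu (hg.tendsto z)).1
  fderiv_tendsto := by
    obtain ⟨A, hA, h₁⟩ := hg.fderiv_tendsto
    refine ⟨insert 0 A, hA.insert 0, ?_⟩
    have hnull : ∀ᵐ z : Eucl n, ∀ p ∈ A, p ≠ 0 → p.1 z + p.2 ≠ 0 := by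
      rw [ae_ball_iff hA.countable]
      intro p _
      by_cases hp : p = 0
      · exact Eventually.of_forall fun z h => absurd hp h
      · have := volume_affine_zero hp
        filter_upwards [compl_mem_ae_iff.2 this] with z hz _ using hz
    have hfd : ∀ k z, fderiv ℝ (fun z => softRelu k (h k z)) z
        = softReluDeriv k (h k z) • fderiv ℝ (h k) z := fun k z =>
      ((hasDerivAt_softRelu k _).comp_hasFDerivAt z (hg.differentiable k z).hasFDerivAt).fderiv
    filter_upwards [h₁, hnull] with z ⟨p, hp, e, t⟩ hz
    simp only [hfd]
    by_cases hp0 : p = 0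
    · refine ⟨0, mem_insert _ _, ?_, ?_⟩
      · filter_upwards [e] with y hy
        simp [hy, hp0]
      · rw [hp0] at t
        have := (t.norm.const_mul (3 / Real.tanh 1 ^ 2))
        simp only [Prod.fst_zero, norm_zero, mul_zero] at this
        refine squeeze_zero_norm (fun k => ?_) this
        rw [norm_smul]
        gcongr
        exact abs_softReluDeriv_le _ _
    · have hpz := hz p hp hp0
      have hgz : g z = p.1 z + p.2 := e.self_of_nhds
      have hlim := (tendsto_softRelu (hg.tendsto z)).2 (by rwa [hgz])
      have hc : ContinuousAt (fun y => p.1 y + p.2) z := by fun_prop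
      rcases lt_or_gt_of_ne hpz with hneg | hpos
      · refine ⟨0, mem_insert _ _, ?_, ?_⟩
        · filter_upwards [e, hc.eventually_lt_const hneg] with y hy hy'
          simp [hy, hy'.le]
        · rw [if_neg (by rw [hgz]; exact not_lt.2 hneg.le)] at hlim
          simpa using hlim.smul t
      · refine ⟨p, mem_insert_of_mem _ hp, ?_, ?_⟩
        · filter_upwards [e, hc.eventually_const_lt hpos] with y hy hy'
          rw [hy, max_eq_left hy'.le]
        · rw [if_pos (by rwa [hgz])] at hlim
          simpa using hlim.smul t

end AELimit

/-- `g` is an almost-everywhere limit of tanh networks with `L` hidden layers of width at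
most `W`. -/
def NetLimit {n : ℕ} (L W : ℕ) (g : Eucl n → ℝ) : Prop :=
  ∃ h : ℕ → Eucl n → ℝ, AELimit h g ∧ ∀ k, Realizes L W (h k)

namespace NetLimit

variable {n : ℕ} {L W W' : ℕ} {g g' : Eucl n → ℝ}

theorem mono (hg : NetLimit L W g) (hW : W ≤ W') : NetLimit L W' g :=
  let ⟨h, h₁, h₂⟩ := hg
  ⟨h, h₁, fun k => (h₂ k).mono hW⟩

theorem zero (L : ℕ) : NetLimit L 0 (0 : Eucl n → ℝ) :=
  ⟨_, AELimit.zero, fun _ => Realizes.zero L⟩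

theorem add (hg : NetLimit L W g) (hg' : NetLimit L W' g') : NetLimit L (W + W') (g + g') :=
  let ⟨_, h₁, h₂⟩ := hg
  let ⟨_, h₁', h₂'⟩ := hg'
  ⟨_, h₁.add h₁', fun k => (h₂ k).add (h₂' k)⟩

theorem smul (a : ℝ) (hg : NetLimit L W g) : NetLimit L W (a • g) :=
  let ⟨_, h₁, h₂⟩ := hg
  ⟨_, h₁.smul a, fun k => (h₂ k).smul a⟩

theorem sum {ι : Type*} (s : Finset ι) {G : ι → Eucl n → ℝ} (hG : ∀ i ∈ s, NetLimit L W (G i)) :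
    NetLimit L (s.card * W) (∑ i ∈ s, G i) := by
  classical
  induction s using Finset.induction_on with
  | empty => simpa using zero L
  | insert i s hi ih =>
    rw [Finset.sum_insert hi, Finset.card_insert_of_notMem hi, add_mul, one_mul, add_comm _ W]
    exact (hG i (Finset.mem_insert_self _ _)).add
      (ih fun j hj => hG j (Finset.mem_insert_of_mem hj))

theorem relu (hg : NetLimit L W g) : NetLimit (L + 2) (max W 3) fun z => max (g z) 0 := by
  obtain ⟨h, h₁, h₂⟩ := hg
  refine ⟨_, h₁.relu, fun k => ?_⟩
  obtain ⟨S, hS, hS'⟩ := h₂ k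
  obtain ⟨S', h₃, h₄⟩ := hS.softRelu k {h k} (by simpa using hS')
  exact ⟨S', by simpa using h₃, h₄ _ (Finset.mem_singleton_self _)⟩

theorem sup (hg : NetLimit L W g) (hg' : NetLimit L W' g') :
    NetLimit (L + 2) (max (W + W') 9) fun z => max (g z) (g' z) := by
  classical
  obtain ⟨a, h₁, h₂⟩ := hg
  obtain ⟨b, h₁', h₂'⟩ := hg'
  -- max(a, b) = (a − b)⁺ + b⁺ − (−b)⁺. Three rectifiers with at most three neurons per layer each
  -- give the width 9.
  refine ⟨_, ((h₁.add (h₁'.smul (-1))).relu.add (h₁'.relu.add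
    ((h₁'.smul (-1)).relu.smul (-1)))).congr (fun _ _ => rfl) fun z => ?_, fun k => ?_⟩
  · simp only [Pi.add_apply, Pi.smul_apply, smul_eq_mul]
    rcases le_total (g z) (g' z) with h | h <;> rcases le_total 0 (g' z) with h' | h' <;>
      simp [h, h']
  · obtain ⟨S, hS, hS'⟩ := h₂ k
    obtain ⟨T, hT, hT'⟩ := h₂' k
    have m₁ : a k ∈ affSpan (S ∪ T) := affSpan_mono Finset.subset_union_left hS'
    have m₂ : b k ∈ affSpan (S ∪ T) := affSpan_mono Finset.subset_union_right hT'
    have m₃ : (-1 : ℝ) • b k ∈ affSpan (S ∪ T) := Submodule.smul_mem _ _ m₂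
    obtain ⟨R, hR, hR'⟩ := (hS.union hT).softRelu k {a k + (-1 : ℝ) • b k, b k, (-1 : ℝ) • b k} (by
      simp only [Finset.mem_insert, Finset.mem_singleton, forall_eq_or_imp, forall_eq]
      exact ⟨Submodule.add_mem _ m₁ m₃, m₂, m₃⟩)
    refine ⟨R, hR.mono (max_le_max le_rfl ?_), Submodule.add_mem _ (hR' _ (by simp))
      (Submodule.add_mem _ (hR' _ (by simp)) (Submodule.smul_mem _ _ (hR' _ (by simp))))⟩
    have := Finset.card_le_three (a := a k + (-1 : ℝ) • b k) (b := b k) (c := (-1 : ℝ) • b k)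
    omega

/-- The maximum of `2 ^ k` functions, by a binary tree. -/
theorem finset_sup' {ι : Type*} (hW : 9 ≤ 2 * W) (k : ℕ) {s : Finset ι} (hs : s.Nonempty)
    (hcard : s.card ≤ 2 ^ k) {G : ι → Eucl n → ℝ} (hG : ∀ i ∈ s, NetLimit L W (G i)) :
    NetLimit (L + 2 * k) (2 ^ k * W) fun z => s.sup' hs fun i => G i z := by
  classical
  induction k generalizing s with
  | zero =>
    obtain ⟨i, rfl⟩ := Finset.card_eq_one.1 (le_antisymm hcard hs.card_pos)
    simpa using hG i (Finset.mem_singleton_self i)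
  | succ k ih =>
    -- A family that is already small is duplicated rather than split, so every branch of the tree
    -- has the same depth.
    obtain ⟨s₁, s₂, h₁, h₂, c₁, c₂, rfl⟩ : ∃ s₁ s₂ : Finset ι, s₁.Nonempty ∧ s₂.Nonempty ∧
        s₁.card ≤ 2 ^ k ∧ s₂.card ≤ 2 ^ k ∧ s₁ ∪ s₂ = s := by
      by_cases hk : s.card ≤ 2 ^ k
      · exact ⟨s, s, hs, hs, hk, hk, Finset.union_self s⟩
      · obtain ⟨t, hts, ht⟩ := Finset.exists_subset_card_eq (not_le.1 hk).le
        have hc := Finset.card_sdiff_of_subset hts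
        refine ⟨t, s \ t, Finset.card_pos.1 (by rw [ht]; positivity),
          Finset.card_pos.1 (by omega), ht.le, ?_, Finset.union_sdiff_of_subset hts⟩
        rw [pow_succ] at hcard
        omega
    have := (ih h₁ c₁ fun i hi => hG i (Finset.mem_union_left _ hi)).sup
      (ih h₂ c₂ fun i hi => hG i (Finset.mem_union_right _ hi))
    have e : (fun z => (s₁ ∪ s₂).sup' hs fun i => G i z)
        = fun z => max (s₁.sup' h₁ fun i => G i z) (s₂.sup' h₂ fun i => G i z) :=
      funext fun z => Finset.sup'_union h₁ h₂ _
    rw [e, show L + 2 * (k + 1) = L + 2 * k + 2 by ring]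
    refine this.mono (max_le (by rw [pow_succ]; ring_nf; rfl) ?_)
    calc 9 ≤ 2 * W := hW
      _ ≤ 2 ^ (k + 1) * W := Nat.mul_le_mul_right _ (by
        rw [pow_succ]; have := Nat.one_le_two_pow (n := k); omega)

/-- An affine function plus a combination of rectified affine functions. -/
theorem affine_add_relu {m : ℕ} (ℓ : Fin (m + 1) → (Eucl n →L[ℝ] ℝ) × ℝ) (i : Fin (m + 1)) (a : ℝ) :
    NetLimit (n := n) 2 (3 * (m + 2)) fun z =>
      ((ℓ i).1 z + (ℓ i).2) + a * ∑ j, max (-((ℓ j).1 z + (ℓ j).2)) 0 := by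
  classical
  have hl := fun j => AELimit.affine (ℓ j).1 (ℓ j).2
  have hsum : ∀ s : Finset (Fin (m + 1)),
      AELimit (fun k => ∑ j ∈ s, fun z => softRelu k (-((ℓ j).1 z + (ℓ j).2)))
        (∑ j ∈ s, fun z => max (-((ℓ j).1 z + (ℓ j).2)) 0) := by
    intro s
    induction s using Finset.induction_on with
    | empty => exact AELimit.zero
    | insert j s hj ih =>
      simp only [Finset.sum_insert hj]
      refine AELimit.add (((hl j).smul (-1)).relu.congr (fun k z => ?_) fun z => ?_) ih <;> simp
  -- The affine term must also cross the two tanh layers, as ℓ = ℓ⁺ − (−ℓ)⁺. The rectifier (−ℓ)⁺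
  -- already occurs in the sum, so m + 2 rectifiers suffice.
  refine ⟨_, (((hl i).relu.add (((hl i).smul (-1)).relu.smul (-1))).add
    ((hsum Finset.univ).smul a)).congr (fun _ _ => rfl) fun z => ?_, fun k => ?_⟩
  · simp only [Pi.add_apply, Pi.smul_apply, smul_eq_mul, Finset.sum_apply]
    congr 1
    generalize (ℓ i).1 z + (ℓ i).2 = x
    rcases le_total 0 x with h | h <;> simp [h]
  · have hmem : ∀ j, (fun z => (ℓ j).1 z + (ℓ j).2) ∈ affSpan (coordFns n) := by
      intro j
      refine Submodule.add_mem _ ?_ (const_mem_affSpan _ _)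
      have : ⇑(ℓ j).1 = ∑ i : Fin n, (ℓ j).1 (EuclideanSpace.single i 1) •
          (fun z : Eucl n => z i) := by
        ext z
        conv_lhs => rw [← (EuclideanSpace.basisFun (Fin n) ℝ).sum_repr z]
        simp [mul_comm]
      rw [this]
      refine Submodule.sum_mem _ fun i _ => Submodule.smul_mem _ _ (mem_affSpan ?_)
      exact Finset.mem_image_of_mem _ (Finset.mem_univ i)
    have hneg : ∀ j, (-1 : ℝ) • (fun z => (ℓ j).1 z + (ℓ j).2) ∈ affSpan (coordFns n) :=
      fun j => Submodule.smul_mem _ _ (hmem j)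
    set H : Finset (Eucl n → ℝ) := insert (fun z => (ℓ i).1 z + (ℓ i).2)
      (Finset.univ.image fun j => (-1 : ℝ) • (fun z => (ℓ j).1 z + (ℓ j).2))
    have hHc : H.card ≤ m + 2 := by
      refine (Finset.card_insert_le _ _).trans ?_
      have := Finset.card_image_le (s := Finset.univ)
        (f := fun j => (-1 : ℝ) • (fun z => (ℓ j).1 z + (ℓ j).2))
      rw [Finset.card_univ, Fintype.card_fin] at this
      omega
    obtain ⟨S, hS, hS'⟩ := IsLayer.softRelu (W := 0) (L := 0) (S := coordFns n) rfl k H (by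
      intro h hh
      rcases Finset.mem_insert.1 hh with rfl | hh
      · exact hmem i
      · obtain ⟨j, -, rfl⟩ := Finset.mem_image.1 hh
        exact hneg j)
    have hHn : ∀ j, (-1 : ℝ) • (fun z => (ℓ j).1 z + (ℓ j).2) ∈ H := fun j =>
      Finset.mem_insert_of_mem (Finset.mem_image_of_mem _ (Finset.mem_univ j))
    refine ⟨S, hS.mono (max_le (Nat.zero_le _) (by omega)), Submodule.add_mem _
      (Submodule.add_mem _ (hS' _ (Finset.mem_insert_self _ _))
        (Submodule.smul_mem _ _ (hS' _ (hHn i))))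
      (Submodule.smul_mem _ _ (Submodule.sum_mem _ fun j _ => ?_))⟩
    have := hS' _ (hHn j)
    simpa using this

end NetLimit

/-! ### Simplices in a conforming partition -/

section Simplex

variable {n : ℕ}

theorem AffineMap.map_weighted_sum {ι : Type*} (s : Finset ι) (A : Eucl n →ᵃ[ℝ] ℝ)
    (w : ι → ℝ) (p : ι → Eucl n) (hw : ∑ i ∈ s, w i = 1) :
    A (∑ i ∈ s, w i • p i) = ∑ i ∈ s, w i * A (p i) := by
  have h : ∀ z, A z = A.linear z + A 0 := fun z => by
    have := A.map_vadd 0 z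
    simpa using this
  rw [h, map_sum]
  simp_rw [h (p _), mul_add, Finset.sum_add_distrib, ← Finset.sum_mul, hw, map_smul, smul_eq_mul,
    one_mul]

/-- The closed simplex spanned by an affine basis. -/
abbrev simplexOf (b : AffineBasis (Fin (n + 1)) ℝ (Eucl n)) : Set (Eucl n) :=
  convexHull ℝ (range b)

variable (b b' : AffineBasis (Fin (n + 1)) ℝ (Eucl n))

theorem mem_simplexOf {z : Eucl n} : z ∈ simplexOf b ↔ ∀ i, 0 ≤ b.coord i z := by
  rw [simplexOf, AffineBasis.convexHull_eq_nonneg_coord]; rfl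

theorem basis_mem_simplexOf (i : Fin (n + 1)) : b i ∈ simplexOf b :=
  subset_convexHull _ _ (mem_range_self i)

theorem affine_eq_sum_coord (A : Eucl n →ᵃ[ℝ] ℝ) (z : Eucl n) :
    A z = ∑ i, b.coord i z * A (b i) := by
  conv_lhs => rw [← b.linear_combination_coord_eq_self z]
  exact AffineMap.map_weighted_sum _ A _ _ (b.sum_coord_apply_eq_one z)

theorem eq_basis_of_coord_eq_zero {z : Eucl n} {i : Fin (n + 1)}
    (h : ∀ j, j ≠ i → b.coord j z = 0) : z = b i := by
  have h₁ := b.sum_coord_apply_eq_one z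
  rw [Finset.sum_eq_single i (fun j _ hj => h j hj) (by simp)] at h₁
  rw [← b.linear_combination_coord_eq_self z,
    Finset.sum_eq_single i (fun j _ hj => by rw [h j hj, zero_smul]) (by simp), h₁, one_smul]

theorem basis_mem_extremePoints (i : Fin (n + 1)) : b i ∈ extremePoints ℝ (simplexOf b) := by
  classical
  rw [mem_extremePoints]
  refine ⟨basis_mem_simplexOf b i, ?_⟩
  intro x hx y hy ⟨s, t, hs, ht, hst, e⟩
  rw [mem_simplexOf] at hx hy
  have key : ∀ j, j ≠ i → b.coord j x = 0 ∧ b.coord j y = 0 := by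
    intro j hj
    have h₁ : b.coord j (b i) = s * b.coord j x + t * b.coord j y := by
      have := AffineMap.map_weighted_sum Finset.univ (b.coord j) ![s, t] ![x, y] (by simpa using hst)
      simp only [Fin.sum_univ_two, Matrix.cons_val_zero, Matrix.cons_val_one] at this
      rw [← this, e]
    rw [b.coord_apply, if_neg hj] at h₁
    have h₂ := mul_nonneg hs.le (hx j)
    have h₃ := mul_nonneg ht.le (hy j)
    constructor
    · exact (mul_eq_zero.1 (by linarith : s * b.coord j x = 0)).resolve_left hs.ne'
    · exact (mul_eq_zero.1 (by linarith : t * b.coord j y = 0)).resolve_left ht.ne'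
  exact ⟨eq_basis_of_coord_eq_zero b fun j hj => (key j hj).1,
    eq_basis_of_coord_eq_zero b fun j hj => (key j hj).2⟩

variable {b b'}

/-- The supporting functional at z is a weighted mean of its vertex values, none larger than the
mean; every vertex of positive weight must attain the maximum. -/
theorem basis_mem_of_isExposed {F : Set (Eucl n)} (hF : IsExposed ℝ (simplexOf b) F) {z : Eucl n}
    (hz : z ∈ F) {j : Fin (n + 1)} (hj : 0 < b.coord j z) : b j ∈ F := by
  obtain ⟨l, rfl⟩ := hF ⟨z, hz⟩
  have hle := fun i => hz.2 (b i) (basis_mem_simplexOf b i)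
  have hl : l (b j) = l z := by
    by_contra hne
    have h₁ : l z = ∑ i, b.coord i z * l (b i) :=
      affine_eq_sum_coord b l.toLinearMap.toAffineMap z
    have h₂ : ∑ i, b.coord i z * l (b i) < ∑ i, b.coord i z * l z := by
      refine Finset.sum_lt_sum (fun i _ => mul_le_mul_of_nonneg_left (hle i)
        ((mem_simplexOf b).1 hz.1 i)) ⟨j, Finset.mem_univ _, ?_⟩
      exact mul_lt_mul_of_pos_left (lt_of_le_of_ne (hle j) hne) hj
    rw [← Finset.sum_mul, b.sum_coord_apply_eq_one, one_mul] at h₂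
    linarith
  exact ⟨basis_mem_simplexOf b j, fun y hy => hl ▸ hz.2 y hy⟩

/-- Conformity excludes hanging vertices. In the first simplex, b' i is a convex combination of
vertices b j; those of positive weight lie in the common face, hence in the second simplex, of which
b' i is a vertex. So each of them equals b' i. -/
theorem exists_basis_eq_of_mem (h₁ : IsExposed ℝ (simplexOf b) (simplexOf b ∩ simplexOf b'))
    {i : Fin (n + 1)} (hi : b' i ∈ simplexOf b) : ∃ j, b j = b' i := by
  classical
  have hz : b' i ∈ simplexOf b ∩ simplexOf b' := ⟨hi, basis_mem_simplexOf b' i⟩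
  have hnn := (mem_simplexOf b).1 hi
  have hmem : ∀ j, 0 < b.coord j (b' i) → b j ∈ simplexOf b' := fun j hj =>
    (basis_mem_of_isExposed h₁ hz hj).2
  obtain ⟨j, hj⟩ : ∃ j, 0 < b.coord j (b' i) := by
    by_contra! hall
    have := b.sum_coord_apply_eq_one (b' i)
    have := Finset.sum_nonpos fun j (_ : j ∈ Finset.univ) => hall j
    linarith
  refine ⟨j, eq_basis_of_coord_eq_zero b' fun i' hi' => ?_⟩
  have e := affine_eq_sum_coord b (b'.coord i') (b' i)
  rw [b'.coord_apply, if_neg hi'] at e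
  have hnn' : ∀ j ∈ Finset.univ, 0 ≤ b.coord j (b' i) * b'.coord i' (b j) := by
    intro j _
    rcases (hnn j).eq_or_lt with h | h
    · rw [← h, zero_mul]
    · exact mul_nonneg h.le ((mem_simplexOf b').1 (hmem j h) i')
  exact (mul_eq_zero.1 ((Finset.sum_eq_zero_iff_of_nonneg hnn').1 e.symm j
    (Finset.mem_univ j))).resolve_left hj.ne'

open Classical in
/-- The total violation of the inequalities defining a simplex dominates the distance to the common
face inside another cell. -/
theorem exists_face_coord_le
    (h₁ : IsExposed ℝ (simplexOf b) (simplexOf b ∩ simplexOf b'))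
    (h₂ : IsExposed ℝ (simplexOf b') (simplexOf b ∩ simplexOf b')) :
    ∃ M : ℝ, 0 ≤ M ∧ ∀ z ∈ simplexOf b',
      ∑ i with b' i ∉ simplexOf b, b'.coord i z ≤ M * ∑ j, max (-b.coord j z) 0 := by
  -- G is the face of the second simplex opposite to the common face. The function ρ collects only
  -- the vertices of the first simplex that are not shared, because their coordinates vanish on all
  -- shared vertices. Positivity of ρ on the compact set G yields the constant.
  set G : Set (Eucl n) := {g | g ∈ simplexOf b' ∧ ∀ i, b' i ∈ simplexOf b → b'.coord i g = 0}
  set ρ : Eucl n → ℝ := fun g => ∑ j with b j ∉ simplexOf b', max (-b.coord j g) 0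
  have hcoord : ∀ (a : AffineBasis (Fin (n + 1)) ℝ (Eucl n)) i, Continuous (a.coord i) :=
    fun a i => continuous_barycentric_coord a i
  have hρc : Continuous ρ := by
    refine continuous_finsetSum _ fun j _ => ?_
    exact ((hcoord b j).neg).max continuous_const
  have hG : IsCompact G := by
    have hK : IsCompact (simplexOf b') := (finite_range b').isCompact_convexHull ℝ
    refine hK.of_isClosed_subset ?_ fun g hg => hg.1
    refine hK.isClosed.inter ?_
    have e : {g | ∀ i, b' i ∈ simplexOf b → b'.coord i g = 0}
        = ⋂ i, ⋂ (_ : b' i ∈ simplexOf b), {g | b'.coord i g = 0} := by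
      ext g
      simp only [mem_iInter]
      rfl
    change IsClosed {g | ∀ i, b' i ∈ simplexOf b → b'.coord i g = 0}
    rw [e]
    exact isClosed_iInter fun i => isClosed_iInter fun _ =>
      isClosed_eq (hcoord b' i) continuous_const
  have hρpos : ∀ g ∈ G, 0 < ρ g := by
    intro g ⟨hgK, hg⟩
    have hnn : ∀ j ∈ Finset.univ.filter (fun j => b j ∉ simplexOf b'),
        0 ≤ max (-b.coord j g) 0 := fun j _ => le_max_right _ _
    refine lt_of_le_of_ne (Finset.sum_nonneg hnn) fun h0 => ?_
    have hz := (Finset.sum_eq_zero_iff_of_nonneg hnn).1 h0.symm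
    have hg0 : ∀ j, b j ∉ simplexOf b' → 0 ≤ b.coord j g := by
      intro j hj
      have := hz j (by simpa using hj)
      have := le_max_left (-b.coord j g) 0
      linarith
    obtain ⟨i, hi⟩ : ∃ i, 0 < b'.coord i g := by
      by_contra! hall
      have := b'.sum_coord_apply_eq_one g
      have := Finset.sum_nonpos fun j (_ : j ∈ Finset.univ) => hall j
      linarith
    -- A common point with positive i-th coordinate would put b' i into the common face, although g
    -- ∈ G has zero weight there.
    have hcontra : ∀ x ∈ simplexOf b ∩ simplexOf b', ¬ 0 < b'.coord i x := fun x hx hpos =>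
      hi.ne' (hg i (basis_mem_of_isExposed h₂ hx hpos).1)
    by_cases hJ : ∃ j, b j ∈ simplexOf b'
    · obtain ⟨j₀, hj₀⟩ := hJ
      set J := Finset.univ.filter fun j => b j ∈ simplexOf b'
      have hJc : 0 < (J.card : ℝ) := by
        exact_mod_cast Finset.card_pos.2 ⟨j₀, Finset.mem_filter.2 ⟨Finset.mem_univ _, hj₀⟩⟩
      have hsum : ∑ _j ∈ J, (J.card : ℝ)⁻¹ = 1 := by
        rw [Finset.sum_const, nsmul_eq_mul, mul_inv_cancel₀ hJc.ne']
      -- Start at the barycentre of the shared vertices and move slightly towards g. Coordinates in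
      -- J stay positive and the others are nonnegative multiples of those of g, so the point
      -- reached lies in both simplices and has positive i-th coordinate.
      set w : Eucl n := ∑ j ∈ J, (J.card : ℝ)⁻¹ • b j
      have hwK' : w ∈ simplexOf b' := (convex_convexHull ℝ _).sum_mem
        (fun _ _ => inv_nonneg.2 hJc.le) hsum fun j hj => (Finset.mem_filter.1 hj).2
      have hwc : ∀ j, b.coord j w = if j ∈ J then (J.card : ℝ)⁻¹ else 0 := by
        intro j
        rw [AffineMap.map_weighted_sum _ _ _ _ hsum]
        simp only [b.coord_apply, mul_ite, mul_one, mul_zero, Finset.sum_ite_eq]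
      have hev : ∀ᶠ s : ℝ in 𝓝[>] 0, ∀ j, 0 ≤ b.coord j (AffineMap.lineMap w g s) := by
        rw [eventually_all]
        intro j
        by_cases hj : j ∈ J
        · have hc : ContinuousAt (fun s : ℝ => b.coord j (AffineMap.lineMap w g s)) 0 :=
            ((hcoord b j).comp AffineMap.lineMap_continuous).continuousAt
          have hpos : 0 < b.coord j (AffineMap.lineMap w g (0 : ℝ)) := by
            rw [AffineMap.lineMap_apply_zero, hwc, if_pos hj]
            exact inv_pos.2 hJc
          exact nhdsWithin_le_nhds ((hc.eventually_const_lt hpos).mono fun s hs => hs.le)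
        · filter_upwards [self_mem_nhdsWithin] with s hs
          rw [AffineMap.apply_lineMap, hwc, if_neg hj, AffineMap.lineMap_apply_module,
            smul_zero, zero_add]
          exact mul_nonneg (le_of_lt hs) (hg0 j fun h =>
            hj (Finset.mem_filter.2 ⟨Finset.mem_univ _, h⟩))
      have hlt : ∀ᶠ s : ℝ in 𝓝[>] 0, s < 1 := nhdsWithin_le_nhds (eventually_lt_nhds one_pos)
      obtain ⟨s, hs, hs1, hs0⟩ := (hev.and (hlt.and self_mem_nhdsWithin)).exists
      have hs0 : 0 < s := hs0
      refine hcontra (AffineMap.lineMap w g s) ⟨(mem_simplexOf b).2 hs, ?_⟩ ?_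
      · exact (convex_convexHull ℝ _).lineMap_mem hwK' hgK ⟨hs0.le, hs1.le⟩
      · rw [AffineMap.apply_lineMap, AffineMap.lineMap_apply_module]
        have h₃ := mul_nonneg (sub_nonneg.2 hs1.le) ((mem_simplexOf b').1 hwK' i)
        have h₄ := mul_pos hs0 hi
        simp only [smul_eq_mul]
        linarith
    · push Not at hJ
      exact hcontra g ⟨(mem_simplexOf b).2 fun j => hg0 j (hJ j), hgK⟩ hi
  obtain ⟨c, hc, hcG⟩ : ∃ c : ℝ, 0 < c ∧ ∀ g ∈ G, c ≤ ρ g := by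
    rcases G.eq_empty_or_nonempty with hemp | hne
    · exact ⟨1, one_pos, fun g hg => by rw [hemp] at hg; exact hg.elim⟩
    · obtain ⟨g, hg, hmin⟩ := hG.exists_isMinOn hne hρc.continuousOn
      exact ⟨ρ g, hρpos g hg, fun y hy => hmin hy⟩
  refine ⟨c⁻¹, by positivity, fun z hz => ?_⟩
  set I := Finset.univ.filter fun i => b' i ∉ simplexOf b
  have hz' := (mem_simplexOf b').1 hz
  set m := ∑ i ∈ I, b'.coord i z with hm
  have hm0 : 0 ≤ m := Finset.sum_nonneg fun i _ => hz' i
  have hρ_nonneg : ∀ y, 0 ≤ ∑ j, max (-b.coord j y) 0 := fun y =>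
    Finset.sum_nonneg fun j _ => le_max_right _ _
  rcases hm0.eq_or_lt with h0 | hpos
  · rw [← h0]
    exact mul_nonneg (by positivity) (hρ_nonneg z)
  have hwsum : ∑ i ∈ I, b'.coord i z / m = 1 := by
    rw [← Finset.sum_div, ← hm, div_self hpos.ne']
  -- The part of z carried by unshared vertices, normalized to a point of G. The coordinates
  -- entering ρ at z are m times those at g, so the bound on G scales to z.
  set g : Eucl n := ∑ i ∈ I, (b'.coord i z / m) • b' i
  have hgG : g ∈ G := by
    refine ⟨(convex_convexHull ℝ _).sum_mem (fun i _ => div_nonneg (hz' i) hm0) hwsum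
      fun i _ => basis_mem_simplexOf b' i, fun i hi => ?_⟩
    rw [AffineMap.map_weighted_sum _ _ _ _ hwsum]
    refine Finset.sum_eq_zero fun i' hi' => ?_
    rw [b'.coord_apply, if_neg, mul_zero]
    rintro rfl
    exact (Finset.mem_filter.1 hi').2 hi
  have hscale : ∀ j, b j ∉ simplexOf b' → b.coord j z = m * b.coord j g := by
    intro j hj
    rw [AffineMap.map_weighted_sum _ _ _ _ hwsum, affine_eq_sum_coord b' (b.coord j) z,
      Finset.mul_sum, Finset.sum_filter]
    refine Finset.sum_congr rfl fun i _ => ?_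
    split_ifs with hi
    · rcases ((mem_simplexOf b).1 hi j).eq_or_lt with h | h
      · rw [← h, mul_zero]
      · exact absurd (basis_mem_of_isExposed h₁ ⟨hi, basis_mem_simplexOf b' i⟩ h).2 hj
    · field_simp
  have h₃ : m * ρ g ≤ ∑ j, max (-b.coord j z) 0 := by
    calc m * ρ g = ∑ j with b j ∉ simplexOf b', max (-b.coord j z) 0 := by
          rw [Finset.mul_sum]
          refine Finset.sum_congr rfl fun j hj => ?_
          rw [hscale j (Finset.mem_filter.1 hj).2, mul_max_of_nonneg _ _ hm0, mul_zero, mul_neg]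
      _ ≤ _ := Finset.sum_le_sum_of_subset_of_nonneg (Finset.filter_subset _ _)
          fun j _ _ => le_max_right _ _
  have h₄ := mul_le_mul_of_nonneg_left (hcG g hgG) hm0
  rw [inv_mul_eq_div, le_div_iff₀ hc]
  linarith

open Classical in
/-- On the simplex spanned by `b`, the hat function of the point `v`: a barycentric coordinate if
`v` is a vertex, and zero otherwise. -/
noncomputable def hatOn (b : AffineBasis (Fin (n + 1)) ℝ (Eucl n)) (v : Eucl n) :
    Eucl n →ᵃ[ℝ] ℝ :=
  if h : ∃ i, b i = v then b.coord h.choose else 0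

theorem hatOn_basis (b : AffineBasis (Fin (n + 1)) ℝ (Eucl n)) (i : Fin (n + 1)) :
    hatOn b (b i) = b.coord i := by
  have h : ∃ j, b j = b i := ⟨i, rfl⟩
  rw [hatOn, dif_pos h, b.ind.injective h.choose_spec]

theorem hatOn_of_not {v : Eucl n} (h : ¬ ∃ i, b i = v) : hatOn b v = 0 := by
  rw [hatOn, dif_neg h]

open Classical in
theorem hatOn_apply_basis (v : Eucl n) (i : Fin (n + 1)) :
    hatOn b v (b i) = if b i = v then 1 else 0 := by
  by_cases h : ∃ j, b j = v
  · obtain ⟨j, rfl⟩ := h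
    rw [hatOn_basis, b.coord_apply]
    simp [b.ind.injective.eq_iff, eq_comm]
  · rw [hatOn_of_not h, if_neg fun h' => h ⟨i, h'⟩]
    rfl

theorem hatOn_nonneg {v z : Eucl n} (hz : z ∈ simplexOf b) : 0 ≤ hatOn b v z := by
  by_cases h : ∃ j, b j = v
  · obtain ⟨j, rfl⟩ := h
    rw [hatOn_basis]
    exact (mem_simplexOf b).1 hz j
  · rw [hatOn_of_not h]
    rfl

/-- The two affine extensions of a hat function agree at shared vertices, so on the second simplex
their difference is controlled by the weight of the unshared vertices, and hence by the penalty
through `exists_face_coord_le`. -/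
theorem exists_hatOn_sub_le
    (h₁ : IsExposed ℝ (simplexOf b) (simplexOf b ∩ simplexOf b'))
    (h₂ : IsExposed ℝ (simplexOf b') (simplexOf b ∩ simplexOf b')) :
    ∃ M : ℝ, 0 ≤ M ∧ ∀ i, ∀ z ∈ simplexOf b',
      hatOn b (b i) z - hatOn b' (b i) z ≤ M * ∑ j, max (-b.coord j z) 0 := by
  classical
  obtain ⟨M, hM, h⟩ := exists_face_coord_le h₁ h₂
  set D : Fin (n + 1) → Eucl n →ᵃ[ℝ] ℝ := fun i => hatOn b (b i) - hatOn b' (b i)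
  set L : ℝ := ∑ i, ∑ i', |D i (b' i')|
  have hL : 0 ≤ L := Finset.sum_nonneg fun _ _ => Finset.sum_nonneg fun _ _ => abs_nonneg _
  have hDL : ∀ i i', D i (b' i') ≤ L := fun i i' =>
    (le_abs_self _).trans <| (Finset.single_le_sum (f := fun i' => |D i (b' i')|)
      (fun _ _ => abs_nonneg _) (Finset.mem_univ i')).trans <|
      Finset.single_le_sum (f := fun i => ∑ i', |D i (b' i')|)
        (fun _ _ => Finset.sum_nonneg fun _ _ => abs_nonneg _) (Finset.mem_univ i)
  refine ⟨L * M, by positivity, fun i z hz => ?_⟩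
  have hD0 : ∀ i', b' i' ∈ simplexOf b → D i (b' i') = 0 := by
    intro i' hi'
    obtain ⟨j, hj⟩ := exists_basis_eq_of_mem h₁ hi'
    change hatOn b (b i) (b' i') - hatOn b' (b i) (b' i') = 0
    rw [hatOn_apply_basis (b := b'), ← hj, hatOn_apply_basis, sub_self]
  have hz' := (mem_simplexOf b').1 hz
  calc hatOn b (b i) z - hatOn b' (b i) z = D i z := rfl
    _ = ∑ i', b'.coord i' z * D i (b' i') := affine_eq_sum_coord b' _ z
    _ ≤ ∑ i' with b' i' ∉ simplexOf b, b'.coord i' z * L := by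
        rw [Finset.sum_filter]
        refine Finset.sum_le_sum fun i' _ => ?_
        split_ifs with hi'
        · rw [hD0 i' hi', mul_zero]
        · exact mul_le_mul_of_nonneg_left (hDL i i') (hz' i')
    _ = L * ∑ i' with b' i' ∉ simplexOf b, b'.coord i' z := by rw [← Finset.sum_mul, mul_comm]
    _ ≤ L * (M * ∑ j, max (-b.coord j z) 0) := mul_le_mul_of_nonneg_left (h z hz) hL
    _ = L * M * ∑ j, max (-b.coord j z) 0 := by ring

end Simplex

/-! ### Piecewise linear functions as limits of networks -/

theorem exists_basis_of_isSimplexCell {n : ℕ} {K : Set (Eucl n)} (hK : IsSimplexCell K) :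
    ∃ b : AffineBasis (Fin (n + 1)) ℝ (Eucl n), K = simplexOf b := by
  obtain ⟨p, hp, rfl⟩ := hK
  exact ⟨⟨p, hp, hp.affineSpan_eq_top_iff_card_eq_finrank_add_one.2 (by simp)⟩, rfl⟩

theorem netLimit_hat {n : ℕ} (b : AffineBasis (Fin (n + 1)) ℝ (Eucl n)) (i : Fin (n + 1)) (a : ℝ) :
    NetLimit 2 (3 * (n + 2)) fun z => hatOn b (b i) z + a * ∑ j, max (-b.coord j z) 0 := by
  have h := NetLimit.affine_add_relu (n := n) (m := n)
    (fun j => ((b.coord j).linear.toContinuousLinearMap, b.coord j 0)) i a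
  have e : ∀ j z, (b.coord j).linear.toContinuousLinearMap z + b.coord j 0 = b.coord j z := by
    intro j z
    have := (b.coord j).map_vadd 0 z
    simpa using this.symm
  simp only [e] at h
  rwa [hatOn_basis]

/-- On a cell containing v its own term has no penalty and equals the hat function, and all other
terms lie below it. On a cell without v the hat function is 0 and every term is at most 0, which
explains the outer maximum with 0. Of the hidden layers, 2 form the penalized coordinates, 2⌈log₂ P⌉
the maximum over the patch and 2 the last rectifier. -/
theorem exists_netLimit_eqOn {n : ℕ} {𝒯 : Finset (Set (Eucl n))} {D : Set (Eucl n)} {P : ℕ}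
    {u : Eucl n → ℝ} (h𝒯 : IsSimplicialPartition 𝒯 D) (hP : PatchBound 𝒯 P)
    (hu : IsCPwL 𝒯 D u) :
    ∃ g, NetLimit (2 * Nat.clog 2 P + 4) (6 * (n + 1) * (n + 2) * (𝒯.card * P)) g ∧
      EqOn g u (closure D) := by
  classical
  have hb : ∀ K : Set (Eucl n), ∃ b : AffineBasis (Fin (n + 1)) ℝ (Eucl n),
      K ∈ 𝒯 → K = simplexOf b := by
    intro K
    by_cases hK : K ∈ 𝒯
    · obtain ⟨b, hb⟩ := exists_basis_of_isSimplexCell (h𝒯.2 K hK)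
      exact ⟨b, fun _ => hb⟩
    · obtain ⟨b⟩ : Nonempty (AffineBasis (Fin (n + 1)) ℝ (Eucl n)) :=
        AffineBasis.exists_affineBasis_of_finiteDimensional (by simp)
      exact ⟨b, fun h => absurd h hK⟩
  choose B hB using hb
  have hmemB : ∀ K ∈ 𝒯, ∀ z, z ∈ K ↔ z ∈ simplexOf (B K) := fun K hK z =>
    Set.ext_iff.1 (hB K hK) z
  have hM : ∀ K K' : Set (Eucl n), ∃ M : ℝ, 0 ≤ M ∧ (K ∈ 𝒯 → K' ∈ 𝒯 → ∀ i, ∀ z ∈ K',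
      hatOn (B K) (B K i) z - hatOn (B K') (B K i) z
        ≤ M * ∑ j, max (-(B K).coord j z) 0) := by
    intro K K'
    by_cases hK : K ∈ 𝒯 ∧ K' ∈ 𝒯 ∧ K ≠ K'
    · obtain ⟨h₁, h₂⟩ := h𝒯.1.conforming K hK.1 K' hK.2.1 hK.2.2
      have e₁ := hB K hK.1
      have e₂ := hB K' hK.2.1
      obtain ⟨M, hM, h⟩ := exists_hatOn_sub_le (b := B K) (b' := B K') (by rwa [← e₁, ← e₂])
        (by rwa [← e₁, ← e₂])
      exact ⟨M, hM, fun _ _ i z hz => h i z ((hmemB K' hK.2.1 z).1 hz)⟩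
    · refine ⟨0, le_rfl, fun h₁ h₂ i z hz => ?_⟩
      have : K = K' := by
        by_contra hne
        exact hK ⟨h₁, h₂, hne⟩
      rw [this, sub_self, zero_mul]
  choose m hm0 hm using hM
  set M : ℝ := ∑ K ∈ 𝒯, ∑ K' ∈ 𝒯, m K K'
  have hmM : ∀ K ∈ 𝒯, ∀ K' ∈ 𝒯, m K K' ≤ M := fun K hK K' hK' =>
    (Finset.single_le_sum (f := fun K' => m K K') (fun _ _ => hm0 _ _) hK').trans <|
      Finset.single_le_sum (f := fun K => ∑ K' ∈ 𝒯, m K K')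
        (fun _ _ => Finset.sum_nonneg fun _ _ => hm0 _ _) hK
  set G : Eucl n → Set (Eucl n) → Eucl n → ℝ := fun v K z =>
    hatOn (B K) v z + (-M) * ∑ j, max (-(B K).coord j z) 0
  set patch : Eucl n → Finset (Set (Eucl n)) := fun v => 𝒯.filter fun K => ∃ i, B K i = v
  set V : Finset (Eucl n) := 𝒯.biUnion fun K => Finset.univ.image (B K)
  have hpatch : ∀ v ∈ V, (patch v).Nonempty := by
    intro v hv
    obtain ⟨K, hK, hv⟩ := Finset.mem_biUnion.1 hv
    obtain ⟨i, -, hi⟩ := Finset.mem_image.1 hv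
    exact ⟨K, Finset.mem_filter.2 ⟨hK, i, hi⟩⟩
  have hpatch_card : ∀ v ∈ V, (patch v).card ≤ P := by
    intro v hv
    obtain ⟨K, hK, hv⟩ := Finset.mem_biUnion.1 hv
    obtain ⟨i, -, rfl⟩ := Finset.mem_image.1 hv
    have h := hP K hK (B K i) (by
      have := basis_mem_extremePoints (B K) i
      rwa [← hB K hK] at this)
    refine le_trans ?_ h
    rw [← Set.ncard_coe_finset]
    refine Set.ncard_le_ncard ?_ (𝒯.finite_toSet.subset fun K' hK' => hK'.1)
    intro K' hK'
    obtain ⟨h₁, i', hi'⟩ := Finset.mem_filter.1 (Finset.mem_coe.1 hK')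
    refine ⟨h₁, ?_⟩
    rw [← hi', hmemB K' h₁]
    exact basis_mem_simplexOf _ _
  set Φ : Eucl n → Eucl n → ℝ := fun v z =>
    if h : (patch v).Nonempty then max ((patch v).sup' h fun K => G v K z) 0 else 0
  have hΦ : ∀ v ∈ V, ∀ K' ∈ 𝒯, ∀ z ∈ K', Φ v z = hatOn (B K') v z := by
    intro v hv K' hK' z hz
    have hz' : z ∈ simplexOf (B K') := (hmemB K' hK' z).1 hz
    simp only [Φ, dif_pos (hpatch v hv)]
    have hnn := hatOn_nonneg (v := v) hz'
    refine le_antisymm (max_le (Finset.sup'_le _ _ fun K hK => ?_) hnn) ?_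
    · obtain ⟨hK₁, i, rfl⟩ := Finset.mem_filter.1 hK
      have h₁ := hm K K' hK₁ hK' i z hz
      have h₂ : m K K' * ∑ j, max (-(B K).coord j z) 0 ≤ M * ∑ j, max (-(B K).coord j z) 0 :=
        mul_le_mul_of_nonneg_right (hmM K hK₁ K' hK')
          (Finset.sum_nonneg fun _ _ => le_max_right _ _)
      simp only [G]
      linarith
    · by_cases hex : ∃ i, B K' i = v
      · refine le_trans ?_ (le_max_left _ _)
        have hmem : K' ∈ patch v := Finset.mem_filter.2 ⟨hK', hex⟩
        refine le_trans (le_of_eq ?_) (Finset.le_sup' (fun K => G v K z) hmem)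
        simp only [G]
        rw [Finset.sum_eq_zero fun j _ => max_eq_right
          (neg_nonpos.2 ((mem_simplexOf _).1 hz' j)), mul_zero, add_zero]
      · rw [hatOn_of_not hex]
        exact le_max_right _ _
  refine ⟨∑ v ∈ V, u v • Φ v, ?_, ?_⟩
  · have hnet : ∀ v ∈ V, NetLimit (2 * Nat.clog 2 P + 4) (2 ^ Nat.clog 2 P * (3 * (n + 2)))
        (u v • Φ v) := by
      intro v hv
      refine NetLimit.smul _ ?_
      have h := (NetLimit.finset_sup' (G := G v) (L := 2) (W := 3 * (n + 2)) (by omega)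
        (Nat.clog 2 P) (hpatch v hv)
        ((hpatch_card v hv).trans (Nat.le_pow_clog one_lt_two P)) (by
          intro K hK
          obtain ⟨-, i, rfl⟩ := Finset.mem_filter.1 hK
          exact netLimit_hat _ _ _)).relu
      have e : Φ v = fun z => max ((patch v).sup' (hpatch v hv) fun K => G v K z) 0 := by
        ext z
        simp only [Φ, dif_pos (hpatch v hv)]
      rw [e, show 2 * Nat.clog 2 P + 4 = 2 + 2 * Nat.clog 2 P + 2 by ring]
      refine h.mono (max_le le_rfl ?_)
      have := Nat.one_le_two_pow (n := Nat.clog 2 P)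
      nlinarith
    refine (NetLimit.sum V hnet).mono ?_
    -- Without vertices P may be 0; a vertex forces P ≥ 1, which is needed to round up to a power of
    -- two at the cost of a factor 2.
    rcases V.eq_empty_or_nonempty with hV | ⟨v, hv⟩
    · simp [hV]
    have hP1 : 1 ≤ P := (hpatch v hv).card_pos.trans_le (hpatch_card v hv)
    have hVc : V.card ≤ 𝒯.card * (n + 1) := by
      refine Finset.card_biUnion_le_card_mul _ _ _ fun K _ => ?_
      simpa using Finset.card_image_le (s := Finset.univ) (f := B K)
    have hpow : 2 ^ Nat.clog 2 P ≤ 2 * P := by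
      rcases hP1.eq_or_lt with h | h
      · rw [← h]; simp
      · have h₁ := Nat.pow_pred_clog_lt_self one_lt_two h
        have h₂ : 0 < Nat.clog 2 P := Nat.clog_pos one_lt_two h
        rw [← Nat.succ_pred_eq_of_pos h₂, pow_succ]
        omega
    calc V.card * (2 ^ Nat.clog 2 P * (3 * (n + 2)))
        ≤ (𝒯.card * (n + 1)) * (2 * P * (3 * (n + 2))) := by gcongr
      _ = 6 * (n + 1) * (n + 2) * (𝒯.card * P) := by ring
  · intro z hz
    rw [← h𝒯.1.covers] at hz
    simp only [mem_iUnion] at hz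
    obtain ⟨K, hK, hz⟩ := hz
    obtain ⟨A, hA⟩ := hu.2 K hK
    have hsub : Finset.univ.image (B K) ⊆ V := Finset.subset_biUnion_of_mem
      (fun K => Finset.univ.image (B K)) hK
    rw [Finset.sum_apply]
    calc ∑ v ∈ V, (u v • Φ v) z = ∑ v ∈ V, u v * hatOn (B K) v z :=
          Finset.sum_congr rfl fun v hv => by
            rw [Pi.smul_apply, smul_eq_mul, hΦ v hv K hK z hz]
      _ = ∑ v ∈ Finset.univ.image (B K), u v * hatOn (B K) v z := by
          refine (Finset.sum_subset hsub fun v _ hv => ?_).symm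
          rw [hatOn_of_not (fun ⟨i, hi⟩ => hv (Finset.mem_image.2 ⟨i, Finset.mem_univ _, hi⟩))]
          simp
      _ = ∑ i, u (B K i) * (B K).coord i z := by
          rw [Finset.sum_image fun i _ j _ h => (B K).ind.injective h]
          simp_rw [hatOn_basis]
      _ = A z := by
          rw [affine_eq_sum_coord (B K) A z]
          refine Finset.sum_congr rfl fun i _ => ?_
          rw [hA ((hmemB K hK _).2 (basis_mem_simplexOf _ _)), mul_comm]
      _ = u z := (hA hz).symm

/-! ### Space-time geometry -/

section SpaceTime

variable {d : ℕ}

@[simp] theorem spacePart_apply (z : Eucl (d + 1)) (i : Fin d) : spacePart z i = z i.castSucc := rfl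

@[simp] theorem stPoint_castSucc (x : Eucl d) (t : ℝ) (i : Fin d) :
    stPoint x t i.castSucc = x i := by
  simp [stPoint]

@[simp] theorem stPoint_last (x : Eucl d) (t : ℝ) : stPoint x t (Fin.last d) = t := by
  simp [stPoint]

@[simp] theorem spacePart_stPoint (x : Eucl d) (t : ℝ) : spacePart (stPoint x t) = x := by
  ext i; simp

@[simp] theorem timePart_stPoint (x : Eucl d) (t : ℝ) : timePart (stPoint x t) = t := by
  simp [timePart]

theorem stPoint_spacePart_timePart (z : Eucl (d + 1)) : stPoint (spacePart z) (timePart z) = z := by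
  ext i
  refine Fin.lastCases ?_ (fun i => ?_) i <;> simp [timePart]

theorem lipschitzWith_spacePart : LipschitzWith 1 (spacePart : Eucl (d + 1) → Eucl d) := by
  refine LipschitzWith.of_dist_le_mul fun x y => ?_
  rw [NNReal.coe_one, one_mul, EuclideanSpace.dist_eq, EuclideanSpace.dist_eq]
  refine Real.sqrt_le_sqrt ?_
  rw [Fin.sum_univ_castSucc (n := d)]
  simp only [spacePart_apply]
  linarith [sq_nonneg (dist (x (Fin.last d)) (y (Fin.last d)))]

theorem continuous_timePart : Continuous (timePart : Eucl (d + 1) → ℝ) := by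
  unfold timePart
  fun_prop

theorem continuous_stPoint : Continuous fun p : Eucl d × ℝ => stPoint p.1 p.2 := by
  unfold stPoint
  refine (PiLp.continuous_toLp 2 _).comp (continuous_pi fun i => ?_)
  refine Fin.lastCases ?_ (fun i => ?_) i
  · simpa using continuous_snd
  · simp only [Fin.snoc_castSucc]
    fun_prop

theorem isOpen_cylinder {Ω : Set (Eucl d)} (hΩ : IsOpen Ω) (T : ℝ) : IsOpen (cylinder Ω T) :=
  (hΩ.preimage lipschitzWith_spacePart.continuous).inter (isOpen_Ioo.preimage continuous_timePart)

theorem isBounded_spaceTime {S : Set (Eucl d)} (hS : Bornology.IsBounded S) (T : ℝ) :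
    Bornology.IsBounded {z : Eucl (d + 1) | spacePart z ∈ S ∧ timePart z ∈ Icc 0 T} := by
  have hc : IsCompact ((fun p : Eucl d × ℝ => stPoint p.1 p.2) '' (closure S ×ˢ Icc 0 T)) :=
    (hS.isCompact_closure.prod isCompact_Icc).image continuous_stPoint
  refine hc.isBounded.subset fun z hz => ?_
  exact ⟨(spacePart z, timePart z), ⟨subset_closure hz.1, hz.2⟩, stPoint_spacePart_timePart z⟩

theorem isBounded_cylinder {Ω : Set (Eucl d)} (hΩ : Bornology.IsBounded Ω) (T : ℝ) :
    Bornology.IsBounded (cylinder Ω T) :=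
  (isBounded_spaceTime hΩ T).subset fun _ hz => ⟨hz.1, Ioo_subset_Icc_self hz.2⟩

theorem stPoint_mem_closure_cylinder {Ω : Set (Eucl d)} {T : ℝ} (hT : 0 < T) {x : Eucl d}
    (hx : x ∈ closure Ω) {t : ℝ} (ht : t ∈ Icc 0 T) : stPoint x t ∈ closure (cylinder Ω T) := by
  have h : (x, t) ∈ closure (Ω ×ˢ Ioo 0 T) := by
    rw [closure_prod_eq, closure_Ioo hT.ne]
    exact ⟨hx, ht⟩
  refine closure_mono ?_ (image_closure_subset_closure_image continuous_stPoint ⟨_, h, rfl⟩)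
  rintro _ ⟨p, hp, rfl⟩
  exact ⟨by simpa using hp.1, by simpa using hp.2⟩

theorem lateralBoundary_subset_closure {Ω : Set (Eucl d)} {T : ℝ} (hT : 0 < T) :
    lateralBoundary Ω T ⊆ closure (cylinder Ω T) := fun z hz => by
  rw [← stPoint_spacePart_timePart z]
  exact stPoint_mem_closure_cylinder hT hz.1.1 (Ioo_subset_Icc_self hz.2)

/-! ### The surface measure of a Lipschitz boundary -/

/-- The hyperplane orthogonal to e is isometric to a d-dimensional Euclidean space, where the
surface measure is Lebesgue measure. -/
theorem euclideanHausdorffMeasure_lt_top_of_orthogonal {e : Eucl (d + 1)} (he : e ≠ 0)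
    {s : Set (Eucl (d + 1))} (hs : Bornology.IsBounded s) (hse : ∀ z ∈ s, inner ℝ e z = 0) :
    μHE[d] s < ∞ := by
  set H : Submodule ℝ (Eucl (d + 1)) := (ℝ ∙ e)ᗮ
  have hfin : Module.finrank ℝ H = d := by
    have : Fact (Module.finrank ℝ (Eucl (d + 1)) = d + 1) := ⟨by simp⟩
    exact Submodule.finrank_orthogonal_span_singleton he
  have hrange : s = ((↑) : H → Eucl (d + 1)) '' ((↑) ⁻¹' s) := by
    rw [image_preimage_eq_inter_range, Subtype.range_coe, eq_comm, inter_eq_left]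
    exact fun z hz => Submodule.mem_orthogonal_singleton_iff_inner_right.2 (hse z hz)
  rw [hrange, Isometry.euclideanHausdorffMeasure_image isometry_subtype_coe]
  have hvol : (μHE[d] : Measure H) = volume := by
    have := InnerProductSpace.euclideanHausdorffMeasure_eq_volume (V := H)
    rwa [hfin] at this
  rw [hvol]
  refine Bornology.IsBounded.measure_lt_top ?_
  exact (isometry_subtype_coe (s := (H : Set (Eucl (d + 1))))).antilipschitz.isBounded_preimage hs

theorem euclideanHausdorffMeasure_image_lt_top {m n : ℕ} {F : Eucl m → Eucl n} {M : ℝ≥0}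
    (hF : LipschitzWith M F) {s : Set (Eucl m)} (hs : μHE[d] s < ∞) : μHE[d] (F '' s) < ∞ := by
  have hne := Measure.addHaarScalarFactor_volume_hausdorffMeasure_ne_zero d
  rw [Measure.euclideanHausdorffMeasure_def, Measure.smul_apply] at hs ⊢
  have h₁ : μH[d] s < ∞ := by
    rw [ENNReal.smul_def, smul_eq_mul] at hs
    exact lt_top_iff_ne_top.2 fun h => by
      rw [h, ENNReal.mul_top (by exact_mod_cast hne)] at hs
      exact lt_irrefl _ hs
  have h₂ := hF.hausdorffMeasure_image_le (d := d) (Nat.cast_nonneg d) s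
  rw [ENNReal.smul_def, smul_eq_mul]
  refine ENNReal.mul_lt_top ENNReal.coe_lt_top (h₂.trans_lt (ENNReal.mul_lt_top ?_ h₁))
  exact ENNReal.rpow_lt_top_of_nonneg (Nat.cast_nonneg d) ENNReal.coe_ne_top

/-- Bounded pieces of Lipschitz graphs have finite surface measure. -/
theorem euclideanHausdorffMeasure_graph_lt_top {e : Eucl (d + 1)} (he : ‖e‖ = 1)
    {ψ : Eucl (d + 1) → ℝ} {M : ℝ≥0} (hψ : LipschitzWith M ψ)
    (hinv : ∀ (y : Eucl (d + 1)) (s : ℝ), ψ (y + s • e) = ψ y)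
    {S : Set (Eucl (d + 1))} (hS : Bornology.IsBounded S) (hSψ : ∀ z ∈ S, inner ℝ e z = ψ z) :
    μHE[d] S < ∞ := by
  have he0 : e ≠ 0 := by rintro rfl; simp at he
  set π : Eucl (d + 1) → Eucl (d + 1) := fun z => z - (inner ℝ e z : ℝ) • e
  set F : Eucl (d + 1) → Eucl (d + 1) := fun y => y + ψ y • e
  have hF : LipschitzWith (1 + M) F := by
    refine LipschitzWith.id.add (LipschitzWith.of_dist_le_mul fun x y => ?_)
    rw [dist_eq_norm, ← sub_smul, norm_smul, he, mul_one]
    exact hψ.dist_le_mul x y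
  -- S is the Lipschitz image, under y ↦ y + ψ(y)e, of its projection to the hyperplane; ψ does not
  -- change under that projection.
  have hsub : S ⊆ F '' (π '' S) := by
    intro z hz
    refine ⟨π z, mem_image_of_mem _ hz, ?_⟩
    have h₁ : ψ (π z) = ψ z := by
      have := hinv z (-(inner ℝ e z : ℝ))
      rwa [neg_smul, ← sub_eq_add_neg] at this
    simp only [F, h₁, ← hSψ z hz]
    exact sub_add_cancel _ _
  refine (measure_mono hsub).trans_lt (euclideanHausdorffMeasure_image_lt_top hF ?_)
  refine euclideanHausdorffMeasure_lt_top_of_orthogonal he0 ?_ ?_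
  · have hc : Continuous π := by fun_prop
    refine ((hS.isCompact_closure.image hc).isBounded).subset (image_mono subset_closure)
  · rintro _ ⟨z, -, rfl⟩
    simp only [π, inner_sub_right, inner_smul_right, real_inner_self_eq_norm_sq, he]
    ring

theorem inner_eq_of_mem_frontier {n : ℕ} {S : Set (Eucl n)} {e x : Eucl n} {φ : Eucl n → ℝ}
    {r : ℝ} (hφ : Continuous φ)
    (h : ∀ y ∈ Metric.ball x r, (φ y < inner ℝ e y → y ∈ S) ∧ (inner ℝ e y < φ y → y ∉ S))
    {y : Eucl n} (hy : y ∈ Metric.ball x r) (hyS : y ∈ frontier S) : inner ℝ e y = φ y := by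
  have hball : ∀ᶠ y' in 𝓝 y, y' ∈ Metric.ball x r := Metric.isOpen_ball.mem_nhds hy
  have hcont : Continuous fun y : Eucl n => (inner ℝ e y : ℝ) := by fun_prop
  rcases lt_trichotomy (inner ℝ e y : ℝ) (φ y) with hlt | heq | hgt
  · exfalso
    have hev : ∀ᶠ y' in 𝓝 y, y' ∉ S := by
      filter_upwards [hball, hcont.continuousAt.eventually_lt hφ.continuousAt hlt] with y' h₁ h₂
      exact (h y' h₁).2 h₂
    have := mem_closure_iff_frequently.1 hyS.1
    exact this hev
  · exact heq
  · exfalso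
    have hev : ∀ᶠ y' in 𝓝 y, y' ∈ S := by
      filter_upwards [hball, hφ.continuousAt.eventually_lt hcont.continuousAt hgt] with y' h₁ h₂
      exact (h y' h₁).1 h₂
    exact hyS.2 (mem_interior_iff_mem_nhds.2 hev)

/-- Compactness of ∂Ω reduces to one chart, which lifts to space-time with direction (e, 0) and a
graph function independent of time. Finiteness turns uniform closeness into L¹ closeness on the
lateral boundary. -/
theorem lateralBoundary_measure_lt_top {Ω : Set (Eucl d)} (hΩ : Bornology.IsBounded Ω)
    (hL : HasLipschitzBoundary Ω) (T : ℝ) : μHE[d] (lateralBoundary Ω T) < ∞ := by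
  have hcomp : IsCompact (frontier Ω) :=
    hΩ.isCompact_closure.of_isClosed_subset isClosed_frontier frontier_subset_closure
  refine hcomp.induction_on
    (p := fun s => μHE[d] {z : Eucl (d + 1) | spacePart z ∈ s ∧ timePart z ∈ Ioo 0 T} < ∞)
    ?_ ?_ ?_ ?_
  · simp
  · intro s t hst ht
    refine lt_of_le_of_lt (measure_mono ?_) ht
    exact fun z hz => ⟨hst hz.1, hz.2⟩
  · intro s t hs ht
    refine (measure_mono ?_).trans_lt ((measure_union_le _ _).trans_lt (ENNReal.add_lt_top.2 ⟨hs, ht⟩))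
    rintro z ⟨hz | hz, hz'⟩
    · exact Or.inl ⟨hz, hz'⟩
    · exact Or.inr ⟨hz, hz'⟩
  · intro x hx
    obtain ⟨e, φ, M, r, he, hφ, hinv, hr, h⟩ := hL x hx
    refine ⟨frontier Ω ∩ Metric.ball x r,
      inter_mem_nhdsWithin _ (Metric.ball_mem_nhds x hr), ?_⟩
    have hinner : ∀ z : Eucl (d + 1), (inner ℝ (stPoint e 0) z : ℝ) = inner ℝ e (spacePart z) := by
      intro z
      simp only [PiLp.inner_apply]
      rw [Fin.sum_univ_castSucc]
      simp
    have hspace : ∀ (y : Eucl (d + 1)) (s : ℝ),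
        spacePart (y + s • stPoint e 0) = spacePart y + s • e := by
      intro y s
      ext i
      simp
    refine euclideanHausdorffMeasure_graph_lt_top (e := stPoint e 0)
      (ψ := fun z => φ (spacePart z)) ?_ (hφ.comp lipschitzWith_spacePart)
      (fun y s => by rw [hspace, hinv]) ?_ ?_
    · have := hinner (stPoint e 0)
      rw [real_inner_self_eq_norm_sq, spacePart_stPoint, real_inner_self_eq_norm_sq, he] at this
      exact (pow_eq_one_iff_of_nonneg (norm_nonneg _) two_ne_zero).1 (by simpa using this)
    · exact (isBounded_spaceTime hcomp.isBounded T).subset fun z hz =>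
        ⟨hz.1.1, Ioo_subset_Icc_self hz.2⟩
    · intro z hz
      rw [hinner]
      exact inner_eq_of_mem_frontier hφ.continuous h hz.1.2 hz.1.1

end SpaceTime

/-! ### Convergence of the residual -/

section Residual

variable {n d : ℕ}

theorem AELimit.exists_lipschitz {h : ℕ → Eucl n → ℝ} {g : Eucl n → ℝ} (hg : AELimit h g) :
    ∃ B : ℝ≥0, (∀ k, LipschitzWith B (h k)) ∧ LipschitzWith B g := by
  obtain ⟨B, hB⟩ := hg.lipschitz
  refine ⟨B, hB, LipschitzWith.of_dist_le_mul fun x y => ?_⟩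
  exact le_of_tendsto ((hg.tendsto x).dist (hg.tendsto y))
    (Eventually.of_forall fun k => (hB k).dist_le_mul x y)

/-- Pointwise convergence on a finite net spreads to all of S by the common Lipschitz constant. -/
theorem AELimit.eventually_abs_sub_lt {h : ℕ → Eucl n → ℝ} {g : Eucl n → ℝ} (hg : AELimit h g)
    {S : Set (Eucl n)} (hS : Bornology.IsBounded S) {η : ℝ} (hη : 0 < η) :
    ∀ᶠ k in atTop, ∀ z ∈ S, |h k z - g z| < η := by
  obtain ⟨B, hB, hBg⟩ := hg.exists_lipschitz
  have hδ : 0 < η / (4 * (B + 1)) := by positivity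
  obtain ⟨t, ht, hcov⟩ := Metric.totallyBounded_iff.1 (hS.isCompact_closure.totallyBounded.subset
    subset_closure) _ hδ
  have hev : ∀ᶠ k in atTop, ∀ y ∈ t, dist (h k y) (g y) < η / 4 := by
    rw [eventually_all_finite ht]
    exact fun y _ => (Metric.tendsto_nhds.1 (hg.tendsto y)) _ (by positivity)
  filter_upwards [hev] with k hk z hz
  obtain ⟨y, hy, hzy⟩ := mem_iUnion₂.1 (hcov hz)
  have hBδ : B * dist z y ≤ η / 4 := by
    calc (B : ℝ) * dist z y ≤ (B + 1) * (η / (4 * (B + 1))) :=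
          mul_le_mul (by linarith) (le_of_lt hzy) dist_nonneg (by positivity)
      _ = η / 4 := by field_simp
  have h₁ := (hB k).dist_le_mul z y
  have h₂ := hBg.dist_le_mul y z
  rw [dist_comm y z] at h₂
  have h₃ := dist_triangle4 (h k z) (h k y) (g y) (g z)
  rw [← Real.dist_eq]
  linarith [hk y hy]

/-- `∇·F` as a function of the value and of the derivative. -/
noncomputable def fluxForm (f : ℝ → Eucl d) (s : ℝ) (ℓ : Eucl (d + 1) →L[ℝ] ℝ) : ℝ :=
  ℓ (EuclideanSpace.single (Fin.last d) 1)
    + ∑ i : Fin d, deriv (fun r => f r i) s * ℓ (EuclideanSpace.single i.castSucc 1)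

theorem contDiff_component {f : ℝ → Eucl d} (hf : ContDiff ℝ 2 f) (i : Fin d) :
    ContDiff ℝ 2 fun r => f r i :=
  (contDiff_euclidean.1 hf) i

theorem continuous_deriv_component {f : ℝ → Eucl d} (hf : ContDiff ℝ 2 f) (i : Fin d) :
    Continuous (deriv fun r => f r i) :=
  (contDiff_component hf i).continuous_deriv (by norm_num)

theorem divF_eq_fluxForm {f : ℝ → Eucl d} (hf : ContDiff ℝ 2 f) {v : Eucl (d + 1) → ℝ}
    {z : Eucl (d + 1)} (hv : DifferentiableAt ℝ v z) :
    divF f v z = fluxForm f (v z) (fderiv ℝ v z) := by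
  rw [divF, fluxForm]
  congr 1
  refine Finset.sum_congr rfl fun i _ => ?_
  have h₁ : HasDerivAt (fun r => f r i) (deriv (fun r => f r i) (v z)) (v z) :=
    ((contDiff_component hf i).differentiable (by norm_num) _).hasDerivAt
  have h₂ : fderiv ℝ (fun y => f (v y) i) z = deriv (fun r => f r i) (v z) • fderiv ℝ v z :=
    (h₁.comp_hasFDerivAt z hv.hasFDerivAt).fderiv
  rw [partialDeriv, h₂]
  rfl

theorem norm_single_one (i : Fin n) : ‖(EuclideanSpace.single i (1 : ℝ) : Eucl n)‖ = 1 := by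
  simp

theorem abs_fluxForm_le (f : ℝ → Eucl d) (s : ℝ) (ℓ : Eucl (d + 1) →L[ℝ] ℝ) :
    |fluxForm f s ℓ| ≤ (1 + ∑ i : Fin d, |deriv (fun r => f r i) s|) * ‖ℓ‖ := by
  have hl : ∀ i, |ℓ (EuclideanSpace.single i 1)| ≤ ‖ℓ‖ := fun i => by
    have := ℓ.le_opNorm (EuclideanSpace.single i 1)
    rwa [norm_single_one, mul_one] at this
  rw [fluxForm, add_mul, one_mul, Finset.sum_mul]
  refine (abs_add_le _ _).trans (add_le_add (hl _) ?_)
  refine (Finset.abs_sum_le_sum_abs _ _).trans (Finset.sum_le_sum fun i _ => ?_)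
  rw [abs_mul]
  exact mul_le_mul_of_nonneg_left (hl _) (abs_nonneg _)

theorem exists_fluxForm_bound {f : ℝ → Eucl d} (hf : ContDiff ℝ 2 f) (R : ℝ) :
    ∃ C : ℝ, 0 < C ∧ ∀ s, |s| ≤ R → ∀ ℓ, |fluxForm f s ℓ| ≤ C * ‖ℓ‖ := by
  have hc : Continuous fun s => 1 + ∑ i : Fin d, |deriv (fun r => f r i) s| :=
    continuous_const.add (continuous_finsetSum _ fun i _ => (continuous_deriv_component hf i).abs)
  obtain ⟨C, hC⟩ := (isCompact_Icc (a := -R) (b := R)).bddAbove_image hc.continuousOn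
  refine ⟨max C 1, by positivity, fun s hs ℓ => (abs_fluxForm_le f s ℓ).trans ?_⟩
  gcongr
  exact (hC ⟨s, abs_le.1 hs, rfl⟩).trans (le_max_left _ _)

theorem measurable_divF (f : ℝ → Eucl d) (v : Eucl (d + 1) → ℝ) : Measurable (divF f v) := by
  refine (measurable_fderiv_apply_const ℝ v _).add
    (Finset.measurable_sum _ fun i _ => measurable_fderiv_apply_const ℝ _ _)

theorem divF_congr {f : ℝ → Eucl d} {v w : Eucl (d + 1) → ℝ} {z : Eucl (d + 1)}
    (h : v =ᶠ[𝓝 z] w) : divF f v z = divF f w z := by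
  simp only [divF, partialDeriv, h.fderiv_eq]
  congr 1
  refine Finset.sum_congr rfl fun i _ => ?_
  have : (fun y => f (v y) i) =ᶠ[𝓝 z] fun y => f (w y) i := by
    filter_upwards [h] with y hy
    rw [hy]
  rw [this.fderiv_eq]

/-- Dominated convergence: values and gradients converge almost everywhere, and the common Lipschitz
constant bounds the gradients. -/
theorem AELimit.tendsto_integral_divF {h : ℕ → Eucl (d + 1) → ℝ} {g : Eucl (d + 1) → ℝ}
    (hg : AELimit h g) {f : ℝ → Eucl d} (hf : ContDiff ℝ 2 f) {S : Set (Eucl (d + 1))}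
    (hSm : MeasurableSet S) (hS : Bornology.IsBounded S) :
    Tendsto (fun k => ∫ z in S, |divF f (h k) z - divF f g z|) atTop (𝓝 0) := by
  obtain ⟨B, hB, hBg⟩ := hg.exists_lipschitz
  obtain ⟨R, hR⟩ : ∃ R, ∀ z ∈ S, |g z| ≤ R := by
    obtain ⟨R, hR⟩ := hS.isCompact_closure.exists_bound_of_continuousOn hBg.continuous.continuousOn
    exact ⟨R, fun z hz => hR z (subset_closure hz)⟩
  -- The margin 1 covers the values of h k, which are eventually within 1 of g on S.
  obtain ⟨C, hC, hCb⟩ := exists_fluxForm_bound hf (R + 1)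
  obtain ⟨A, -, hA⟩ := hg.fderiv_tendsto
  have hfin : IsFiniteMeasure (volume.restrict S) := ⟨by
    rw [Measure.restrict_apply_univ]; exact hS.measure_lt_top⟩
  have hdiv : ∀ᵐ z, divF f g z = fluxForm f (g z) (fderiv ℝ g z) ∧
      Tendsto (fun k => divF f (h k) z) atTop (𝓝 (divF f g z)) := by
    filter_upwards [hA] with z ⟨p, _, e, t⟩
    have hd : HasFDerivAt g p.1 z := by
      refine HasFDerivAt.congr_of_eventuallyEq ?_ e
      exact p.1.hasFDerivAt.add_const p.2
    have h₁ := divF_eq_fluxForm hf hd.differentiableAt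
    refine ⟨h₁, ?_⟩
    rw [h₁, hd.fderiv]
    refine Tendsto.congr (fun k => (divF_eq_fluxForm hf (hg.differentiable k z)).symm) ?_
    have hev : ∀ i : Fin (d + 1), Tendsto (fun k => fderiv ℝ (h k) z (EuclideanSpace.single i 1))
        atTop (𝓝 (p.1 (EuclideanSpace.single i 1))) := fun i =>
      ((ContinuousLinearMap.apply ℝ ℝ (EuclideanSpace.single i (1 : ℝ))).continuous.tendsto _).comp t
    refine (hev _).add (tendsto_finsetSum _ fun i _ => ?_)
    exact (((continuous_deriv_component hf i).tendsto _).comp (hg.tendsto z)).mul (hev _)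
  have hlim := tendsto_integral_filter_of_dominated_convergence (μ := volume.restrict S)
    (F := fun k z => |divF f (h k) z - divF f g z|) (f := fun _ => 0) (l := atTop)
    (fun _ => C * B + C * B) ?_ ?_ ?_ ?_
  · simpa using hlim
  · exact Eventually.of_forall fun k =>
      ((measurable_divF f (h k)).sub (measurable_divF f g)).abs.aestronglyMeasurable
  · filter_upwards [hg.eventually_abs_sub_lt hS one_pos] with k hk
    filter_upwards [ae_restrict_of_ae hdiv, ae_restrict_mem hSm] with z hz hzS
    rw [norm_abs_eq_norm]
    refine (norm_sub_le _ _).trans (add_le_add ?_ ?_) <;> rw [Real.norm_eq_abs]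
    · rw [divF_eq_fluxForm hf (hg.differentiable k z)]
      refine (hCb _ ?_ _).trans (mul_le_mul_of_nonneg_left
        (norm_fderiv_le_of_lipschitz ℝ (hB k)) hC.le)
      have h₁ := hR z hzS
      have h₂ := abs_add_le (h k z - g z) (g z)
      rw [sub_add_cancel] at h₂
      linarith [hk z hzS]
    · rw [hz.1]
      exact (hCb _ ((hR z hzS).trans (by linarith)) _).trans (mul_le_mul_of_nonneg_left
        (norm_fderiv_le_of_lipschitz ℝ hBg) hC.le)
  · exact integrable_const _
  · filter_upwards [ae_restrict_of_ae hdiv] with z hz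
    have := (hz.2.sub_const (divF f g z)).abs
    simpa using this

end Residual

/-! ### Thin level sets -/

/-- Translate S by multiples of 1/J along e. A shift by at least 1/J changes w by at least m/J = 4η,
while w varies by at most 2η on S, so J translates are disjoint; they fit into a ball of radius R +
1, whose volume is less than Jε. The choice of η involves neither e, S nor w, which gives uniformity
in the test function. -/
theorem exists_slab_measure_le {n : ℕ} (R : ℝ) {m ε : ℝ} (hm : 0 < m) (hε : 0 < ε) :
    ∃ η : ℝ, 0 < η ∧ ∀ (e : Eucl n) (S : Set (Eucl n)) (w : Eucl n → ℝ), ‖e‖ = 1 →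
      S ⊆ Metric.ball 0 R → MeasurableSet S → (∀ x ∈ S, |w x| ≤ η) →
      (∀ x ∈ S, ∀ t : ℝ, 0 ≤ t → x + t • e ∈ S → m * t ≤ w (x + t • e) - w x) →
      volume S ≤ ENNReal.ofReal ε := by
  set V : ℝ := (volume (Metric.ball (0 : Eucl n) (R + 1))).toReal
  have hV : volume (Metric.ball (0 : Eucl n) (R + 1)) = ENNReal.ofReal V :=
    (ENNReal.ofReal_toReal Metric.isBounded_ball.measure_lt_top.ne).symm
  obtain ⟨J, hJ⟩ := exists_nat_gt (V / ε)
  have hJ0 : (0 : ℝ) < J := lt_of_le_of_lt (div_nonneg ENNReal.toReal_nonneg hε.le) hJ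
  refine ⟨m / (4 * J), by positivity, fun e S w he hSR hSm hSw hmono => ?_⟩
  set τ : ℕ → Eucl n := fun j => ((j : ℝ) / J) • e
  set P : ℕ → Set (Eucl n) := fun j => (fun z => z + τ j) ⁻¹' S
  have hPvol : ∀ j, volume (P j) = volume S := fun j => measure_preimage_add_right _ _ _
  have hPm : ∀ j, MeasurableSet (P j) := fun j => hSm.preimage (measurable_id.add_const _)
  have hlt : ∀ i j : ℕ, i < j → Disjoint (P i) (P j) := by
    intro i j hij
    rw [Set.disjoint_left]
    intro z hi hj
    have hi' : z + τ i ∈ S := hi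
    have e₁ : z + τ j = z + τ i + (((j : ℝ) - i) / J) • e := by
      simp only [τ, sub_div, sub_smul]
      abel
    have hj' : z + τ i + (((j : ℝ) - i) / J) • e ∈ S := e₁ ▸ hj
    have hji : (1 : ℝ) ≤ (j : ℝ) - i := by
      have : (i : ℝ) + 1 ≤ j := by exact_mod_cast hij
      linarith
    have h₁ := hmono _ hi' _ (by positivity) hj'
    have h₂ := abs_le.1 (hSw _ hi')
    have h₃ := abs_le.1 (hSw _ hj')
    have h₄ : m * (1 / J) ≤ m * (((j : ℝ) - i) / J) := by gcongr
    have h₅ : m * (1 / J) = 4 * (m / (4 * J)) := by field_simp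
    have h₆ : 0 < m / (4 * J) := by positivity
    linarith
  have hdisj : PairwiseDisjoint (↑(Finset.range J)) P := by
    intro i _ j _ hij
    rcases lt_or_gt_of_ne hij with h | h
    · exact hlt i j h
    · exact (hlt j i h).symm
  have hsub : (⋃ j ∈ Finset.range J, P j) ⊆ Metric.ball 0 (R + 1) := by
    intro z hz
    obtain ⟨j, hj, hz⟩ := mem_iUnion₂.1 hz
    have h₁ := hSR hz
    rw [mem_ball_zero_iff] at h₁ ⊢
    have h₂ : ‖τ j‖ ≤ 1 := by
      rw [norm_smul, he, mul_one, Real.norm_of_nonneg (by positivity)]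
      have : (j : ℝ) < J := by exact_mod_cast Finset.mem_range.1 hj
      exact (div_le_one hJ0).2 this.le
    have h₃ := norm_sub_le (z + τ j) (τ j)
    rw [add_sub_cancel_right] at h₃
    linarith
  have hmeas := measure_mono (μ := volume) hsub
  rw [measure_biUnion_finset hdisj fun j _ => hPm j] at hmeas
  simp only [hPvol, Finset.sum_const, Finset.card_range, nsmul_eq_mul, hV] at hmeas
  have hSfin : volume S ≠ ∞ := (Metric.isBounded_ball.subset hSR).measure_lt_top.ne
  rw [← ENNReal.ofReal_toReal hSfin] at hmeas ⊢
  rw [← ENNReal.ofReal_natCast, ← ENNReal.ofReal_mul hJ0.le,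
    ENNReal.ofReal_le_ofReal_iff ENNReal.toReal_nonneg] at hmeas
  refine ENNReal.ofReal_le_ofReal ?_
  rw [div_lt_iff₀ hε] at hJ
  nlinarith

/-! ### Cells and discrete test functions -/

section Cells

variable {n : ℕ}

theorem contDiff_mvPolynomial_eval (p : MvPolynomial (Fin n) ℝ) :
    ContDiff ℝ 1 fun z : Eucl n => MvPolynomial.eval (fun i => z i) p := by
  induction p using MvPolynomial.induction_on with
  | C a => simpa using contDiff_const
  | add p q hp hq => simpa using hp.add hq
  | mul_X p i hp =>
    simp only [map_mul, MvPolynomial.eval_X]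
    exact hp.mul (by fun_prop)

theorem norm_gradient (k : Eucl n → ℝ) (z : Eucl n) : ‖gradient k z‖ = ‖fderiv ℝ k z‖ := by
  rw [gradient, LinearIsometryEquiv.norm_map]

theorem CLaw.IsBoxCell.convex {K : Set (Eucl n)} (hK : IsBoxCell K) : Convex ℝ K := by
  obtain ⟨a, b, -, rfl⟩ := hK
  intro x hx y hy s t hs ht hst i
  have h₁ := hx i
  have h₂ := hy i
  have e : (s • x + t • y) i = s * x i + t * y i := by simp
  rw [e]
  have l₁ := mul_le_mul_of_nonneg_left h₁.1 hs
  have l₂ := mul_le_mul_of_nonneg_left h₁.2 hs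
  have l₃ := mul_le_mul_of_nonneg_left h₂.1 ht
  have l₄ := mul_le_mul_of_nonneg_left h₂.2 ht
  have m₁ : s * a i + t * a i = a i := by rw [← add_mul, hst, one_mul]
  have m₂ : s * b i + t * b i = b i := by rw [← add_mul, hst, one_mul]
  constructor <;> linarith

theorem cell_convex {K : Set (Eucl n)} (hK : IsBoxCell K ∨ IsSimplexCell K) : Convex ℝ K := by
  rcases hK with h | ⟨p, -, rfl⟩
  · exact h.convex
  · exact convex_convexHull ℝ _

theorem exists_cell_ne [NeZero n] {K : Set (Eucl n)} (hK : IsBoxCell K ∨ IsSimplexCell K) :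
    ∃ x ∈ K, ∃ y ∈ K, x ≠ y := by
  rcases hK with ⟨a, b, hab, rfl⟩ | ⟨p, hp, rfl⟩
  · exact ⟨a, fun i => ⟨le_rfl, (hab i).le⟩, b, fun i => ⟨(hab i).le, le_rfl⟩, fun h =>
      (hab 0).ne (by rw [h])⟩
  · refine ⟨p 0, subset_convexHull _ _ (mem_range_self _), p (Fin.last n),
      subset_convexHull _ _ (mem_range_self _), fun h => ?_⟩
    have := congrArg Fin.val (hp.injective h)
    simp at this
    exact NeZero.ne n this.symm

variable {cells : Finset (Set (Eucl n))} {D : Set (Eucl n)}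

theorem CLaw.IsConformingPartition.cell_subset (hc : IsConformingPartition cells D)
    {K : Set (Eucl n)} (hK : K ∈ cells) : K ⊆ closure D := by
  rw [← hc.covers]
  exact subset_biUnion_of_mem (u := fun K => K) hK

theorem CLaw.IsConformingPartition.meshSize_pos [NeZero n] (hc : IsConformingPartition cells D)
    (hD : Bornology.IsBounded D) (hne : D.Nonempty) : 0 < meshSize cells := by
  obtain ⟨z, hz⟩ := hne
  have hz' := subset_closure hz
  rw [← hc.covers] at hz'
  obtain ⟨K, hK, -⟩ := mem_iUnion₂.1 hz'
  obtain ⟨x, hx, y, hy, hxy⟩ := exists_cell_ne (hc.isCell K hK)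
  have hb : Bornology.IsBounded K := hD.closure.subset (hc.cell_subset hK)
  have h₁ := Metric.dist_le_diam_of_mem hb hx hy
  have h₂ : (Metric.diam K).toNNReal ≤ cells.sup fun K => (Metric.diam K).toNNReal :=
    Finset.le_sup (f := fun K : Set (Eucl n) => (Metric.diam K).toNNReal) hK
  have h₃ : 0 < (Metric.diam K).toNNReal := Real.toNNReal_pos.2 ((dist_pos.2 hxy).trans_le h₁)
  exact_mod_cast h₃.trans_le h₂

theorem CLaw.IsConformingPartition.ae_mem_interior (hc : IsConformingPartition cells D) :
    ∀ᵐ z, z ∈ D → ∃ K ∈ cells, z ∈ interior K := by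
  have h : ∀ᵐ z, ∀ K ∈ (cells : Set (Set (Eucl n))), z ∉ frontier K := by
    rw [ae_ball_iff cells.countable_toSet]
    intro K hK
    exact compl_mem_ae_iff.2 ((cell_convex (hc.isCell K hK)).addHaar_frontier volume)
  filter_upwards [h] with z hz hzD
  have hz' := subset_closure hzD
  rw [← hc.covers] at hz'
  obtain ⟨K, hK, hzK⟩ := mem_iUnion₂.1 hz'
  refine ⟨K, hK, ?_⟩
  by_contra hint
  exact hz K hK ⟨subset_closure hzK, hint⟩

/-- A discrete test function agrees inside each cell with a `C¹` function, and is Lipschitz there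
with constant `c / h`. -/
theorem exists_eqOn_of_mem_Vhc (hc : IsConformingPartition cells D) {c : ℝ} (hcpos : 0 < c)
    (hh : 0 < meshSize cells) {k : Eucl n → ℝ} (hk : k ∈ Vhc cells c) {K : Set (Eucl n)}
    (hK : K ∈ cells) :
    ∃ q : Eucl n → ℝ, Continuous q ∧ EqOn k q (interior K) ∧
      ∀ x ∈ interior K, ∀ y ∈ interior K, |q y - q x| ≤ c / meshSize cells * ‖y - x‖ := by
  obtain ⟨p, -, -, hp⟩ := hk.1 K hK
  set q : Eucl n → ℝ := fun z => MvPolynomial.eval (fun i => z i) p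
  have hq : ContDiff ℝ 1 q := contDiff_mvPolynomial_eval p
  refine ⟨q, hq.continuous, hp, fun x hx y hy => ?_⟩
  have hnorm : eLpNorm (gradient k) ∞ (volume.restrict K)
      ≤ ENNReal.ofReal (c / meshSize cells) := by
    have h₁ := (le_iSup₂ (f := fun K (_ : K ∈ cells) => eLpNorm k ∞ (volume.restrict K)
      + ENNReal.ofReal (meshSize cells) * eLpNorm (gradient k) ∞ (volume.restrict K)) K hK).trans
      hk.2
    have h₂ := le_add_self.trans h₁
    rw [ENNReal.ofReal_div_of_pos hh, ENNReal.le_div_iff_mul_le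
      (Or.inl (ENNReal.ofReal_pos.2 hh).ne') (Or.inl ENNReal.ofReal_ne_top), mul_comm]
    exact h₂
  have hae : ∀ᵐ z ∂volume.restrict K, ‖gradient k z‖ ≤ c / meshSize cells := by
    rw [eLpNorm_exponent_top] at hnorm
    filter_upwards [ae_le_eLpNormEssSup (f := gradient k) (μ := volume.restrict K)] with z hz
    have h₁ := hz.trans hnorm
    rw [← ofReal_norm] at h₁
    exact (ENNReal.ofReal_le_ofReal_iff (by positivity)).1 h₁
  have hfd : Continuous (fderiv ℝ q) := hq.continuous_fderiv (by norm_num)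
  -- The essential bound becomes pointwise: `fderiv ℝ q` is continuous, so a violation would occur
  -- on a nonempty open null set.
  have hall : ∀ z ∈ interior K, ‖fderiv ℝ q z‖ ≤ c / meshSize cells := by
    by_contra! hcon
    set U : Set (Eucl n) := interior K ∩ {z | c / meshSize cells < ‖fderiv ℝ q z‖}
    have hU : IsOpen U := isOpen_interior.inter (isOpen_lt continuous_const hfd.norm)
    have hU0 : volume U = 0 := by
      have h₁ : volume.restrict K {z | ¬ ‖gradient k z‖ ≤ c / meshSize cells} = 0 :=
        ae_iff.1 hae
      refine measure_mono_null (fun z hz => ?_)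
        (nonpos_iff_eq_zero.1 ((Measure.le_restrict_apply _ _).trans_eq h₁))
      refine ⟨?_, interior_subset hz.1⟩
      have e : k =ᶠ[𝓝 z] q := by
        filter_upwards [isOpen_interior.mem_nhds hz.1] with y hy using hp y hy
      change ¬ ‖gradient k z‖ ≤ c / meshSize cells
      rw [norm_gradient, e.fderiv_eq, not_le]
      exact hz.2
    obtain ⟨z, hz, hz'⟩ := hcon
    have := hU.eq_empty_of_measure_zero hU0
    exact notMem_empty z (this ▸ ⟨hz, hz'⟩)
  have := (cell_convex (hc.isCell K hK)).interior.norm_image_sub_le_of_norm_fderiv_le (𝕜 := ℝ)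
    (fun z _ => (hq.differentiable (by norm_num)) z) hall hx hy
  exact this

/-- Values on the skeleton are arbitrary, but the skeleton is null and k is polynomial inside each
cell. -/
theorem aemeasurable_of_mem_Vhc (hc : IsConformingPartition cells D)
    {k : Eucl n → ℝ} (hk : MemVh cells k) : AEMeasurable k (volume.restrict D) := by
  have h₁ : AEMeasurable k (volume.restrict (⋃ K ∈ cells, interior K)) := by
    rw [← Finset.set_biUnion_coe, biUnion_eq_iUnion]
    refine aemeasurable_iUnion_iff.2 fun K => ?_
    obtain ⟨p, -, -, hp⟩ := hk K K.2
    have hq := (contDiff_mvPolynomial_eval p).continuous.measurable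
    exact hq.aemeasurable.congr ((ae_restrict_mem measurableSet_interior).mono
      fun z hz => (hp z hz).symm)
  have h₂ : D =ᵐ[volume] (D ∩ ⋃ K ∈ cells, interior K : Set (Eucl n)) := by
    filter_upwards [hc.ae_mem_interior] with z hz
    refine propext ⟨fun h => ⟨h, ?_⟩, fun h => h.1⟩
    obtain ⟨K, hK, hzK⟩ := hz h
    exact mem_iUnion₂.2 ⟨K, hK, hzK⟩
  rw [Measure.restrict_congr_set h₂]
  exact h₁.mono_measure (Measure.restrict_mono inter_subset_right le_rfl)

end Cells

/-! ### Comparison of the losses -/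

theorem abs_sign_le_one (x : ℝ) : |Real.sign x| ≤ 1 := by
  rcases Real.sign_apply_eq x with h | h | h <;> rw [h] <;> simp

theorem measurable_sign : Measurable Real.sign := by
  have : Real.sign = fun r : ℝ => if r < 0 then (-1 : ℝ) else if 0 < r then 1 else 0 := by
    ext r; rfl
  rw [this]
  exact Measurable.ite measurableSet_Iio measurable_const
    (Measurable.ite measurableSet_Ioi measurable_const measurable_const)

theorem sign_eq_of_abs_sub_lt {a b η : ℝ} (h : |a - b| < η) (hb : η < |b|) :
    Real.sign a = Real.sign b := by
  have h₁ := abs_lt.1 h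
  rcases lt_abs.1 hb with h₂ | h₂
  · rw [Real.sign_of_pos (by linarith [abs_nonneg (a - b)] : 0 < b),
      Real.sign_of_pos (by linarith : 0 < a)]
  · rw [Real.sign_of_neg (by linarith [abs_nonneg (a - b)] : b < 0),
      Real.sign_of_neg (by linarith : a < 0)]

theorem exists_unit_apply_eq_norm {n : ℕ} {ℓ : Eucl n →L[ℝ] ℝ} (hℓ : 0 < ‖ℓ‖) :
    ∃ e : Eucl n, ‖e‖ = 1 ∧ ℓ e = ‖ℓ‖ := by
  set v := (InnerProductSpace.toDual ℝ (Eucl n)).symm ℓ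
  have hv : ‖v‖ = ‖ℓ‖ := LinearIsometryEquiv.norm_map _ _
  have hvℓ : ℓ v = ‖ℓ‖ ^ 2 := by
    rw [← hv, ← real_inner_self_eq_norm_sq, InnerProductSpace.toDual_symm_apply]
  refine ⟨‖ℓ‖⁻¹ • v, ?_, ?_⟩
  · rw [norm_smul, hv, norm_inv, norm_norm, inv_mul_cancel₀ hℓ.ne']
  · rw [map_smul, hvℓ, smul_eq_mul]
    field_simp

/-- Where an affine function is steeper than the discrete test functions, it is close to a test
function only on a small set, uniformly in the test function. -/
theorem exists_level_measure_le {n : ℕ} {cells : Finset (Set (Eucl n))} {D : Set (Eucl n)}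
    (hc : IsConformingPartition cells D) {c : ℝ} (hcpos : 0 < c) (hh : 0 < meshSize cells)
    (R : ℝ) {ε : ℝ} (hε : 0 < ε) :
    ∃ η : ℝ, 0 < η ∧ ∀ k ∈ Vhc cells c, ∀ K ∈ cells, ∀ U : Set (Eucl n), MeasurableSet U →
      U ⊆ Metric.ball 0 R → ∀ (ℓ : Eucl n →L[ℝ] ℝ) (a : ℝ),
      MeasurableSet {z | z ∈ U ∩ interior K ∧ |ℓ z + a - k z| ≤ η} ∧
      (2 * (c / meshSize cells) < ‖ℓ‖ →
        volume {z | z ∈ U ∩ interior K ∧ |ℓ z + a - k z| ≤ η} ≤ ENNReal.ofReal ε) := by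
  have hm : 0 < c / meshSize cells := div_pos hcpos hh
  obtain ⟨η, hη, h⟩ := exists_slab_measure_le (n := n) R hm hε
  refine ⟨η, hη, fun k hk K hK U hU hUR ℓ a => ?_⟩
  obtain ⟨q, hq, hkq, hlip⟩ := exists_eqOn_of_mem_Vhc hc hcpos hh hk hK
  have hmeas : MeasurableSet {z | z ∈ U ∩ interior K ∧ |ℓ z + a - k z| ≤ η} := by
    have e : {z | z ∈ U ∩ interior K ∧ |ℓ z + a - k z| ≤ η}
        = (U ∩ interior K) ∩ {z | |ℓ z + a - q z| ≤ η} := by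
      ext z
      change z ∈ U ∩ interior K ∧ |ℓ z + a - k z| ≤ η ↔ z ∈ U ∩ interior K ∧ |ℓ z + a - q z| ≤ η
      refine and_congr_right fun hz => ?_
      rw [hkq hz.2]
    rw [e]
    exact (hU.inter measurableSet_interior).inter (isClosed_le
      (((ℓ.continuous.add continuous_const).sub hq).abs) continuous_const).measurableSet
  refine ⟨hmeas, fun hℓ => ?_⟩
  obtain ⟨e, he, heℓ⟩ := exists_unit_apply_eq_norm (lt_trans (by positivity) hℓ)
  refine h e _ (fun z => ℓ z + a - k z) he (fun z hz => hUR hz.1.1) hmeas (fun z hz => hz.2) ?_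
  -- Along e the affine part grows by more than 2(c/h)t and k by at most (c/h)t, since both points
  -- lie in the interior of one cell; a slope c/h remains.
  intro x hx t ht hxt
  have h₁ := hlip x hx.1.2 _ hxt.1.2
  rw [← hkq hx.1.2, ← hkq hxt.1.2, add_sub_cancel_left, norm_smul, he, mul_one,
    Real.norm_of_nonneg ht] at h₁
  have h₂ := (abs_le.1 h₁).2
  have h₃ : t * (2 * (c / meshSize cells)) ≤ t * ‖ℓ‖ := mul_le_mul_of_nonneg_left hℓ.le ht
  simp only [map_add, map_smul, smul_eq_mul, heℓ]
  linarith

section Loss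

variable {d : ℕ}

/-- The threshold η precedes both k and v, as the supremum over k requires. The pointwise error has
four parts: F₂ for the change of the residual, F₃ for possible sign flips on Ω_r, F₄ for flips on
Ω_s where u is not steep, and F₅ for flips on steep cells. -/
theorem exists_entropyResidual_le {f : ℝ → Eucl d} {Ω : Set (Eucl d)} {T : ℝ}
    {Λ 𝒯 : Finset (Set (Eucl (d + 1)))} {u : Eucl (d + 1) → ℝ} {c CΩ Cf ε : ℝ}
    {Ωr Ωs : Set (Eucl (d + 1))} (hDo : IsOpen (cylinder Ω T))
    (hDb : Bornology.IsBounded (cylinder Ω T)) (hΛ : IsConformingPartition Λ (cylinder Ω T))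
    (hh : 0 < meshSize Λ) (h𝒯 : IsConformingPartition 𝒯 (cylinder Ω T))
    (hu : IsCPwL 𝒯 (cylinder Ω T) u) (hc : 0 < c) (hCΩ : 0 < CΩ) (hCf : 0 < Cf)
    (hdiv : ∀ᵐ z ∂volume.restrict (cylinder Ω T), |divF f u z| ≤ Cf * ‖fderiv ℝ u z‖)
    (hint : IntegrableOn (divF f u) (cylinder Ω T))
    (hr : MeasurableSet Ωr) (hs : MeasurableSet Ωs) (hrs : cylinder Ω T = Ωr ∪ Ωs)
    (hvol : volume Ωs ≤ ENNReal.ofReal (CΩ * meshSize Λ ^ 2)) (hε : 0 < ε) :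
    ∃ η : ℝ, 0 < η ∧ ∀ k ∈ Vhc Λ c, ∀ v : Eucl (d + 1) → ℝ, ContinuousOn v (cylinder Ω T) →
      IntegrableOn (divF f v) (cylinder Ω T) → (∀ z ∈ cylinder Ω T, |v z - u z| < η) →
      entropyResidual f Ω T v k ≤ entropyResidual f Ω T u k
        + (∫ z in cylinder Ω T, |divF f v z - divF f u z|)
        + 2 * (∫ z in Ωr, |divF f u z|) + 4 * c * Cf * CΩ * meshSize Λ + ε := by
  classical
  set D := cylinder Ω T
  set h := meshSize Λ
  have hDm : MeasurableSet D := hDo.measurableSet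
  have hDfin : IsFiniteMeasure (volume.restrict D) := ⟨by
    rw [Measure.restrict_apply_univ]; exact hDb.measure_lt_top⟩
  have hcell : ∀ K : Set (Eucl (d + 1)), ∃ p : (Eucl (d + 1) →L[ℝ] ℝ) × ℝ,
      K ∈ 𝒯 → ∀ z ∈ K, u z = p.1 z + p.2 := by
    intro K
    by_cases hK : K ∈ 𝒯
    · obtain ⟨A, hA⟩ := hu.2 K hK
      refine ⟨(A.linear.toContinuousLinearMap, A 0), fun _ z hz => ?_⟩
      rw [hA hz]
      have := A.map_vadd 0 z
      simpa using this
    · exact ⟨0, fun h => absurd h hK⟩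
  choose p hp using hcell
  obtain ⟨R, hR⟩ := hDb.closure.subset_ball 0
  -- Total weight of the steep contributions; level sets of measure at most ε/(N+1) make their
  -- integral at most ε.
  set N : ℝ := ∑ K ∈ 𝒯, ∑ _K' ∈ Λ, 2 * (Cf * ‖(p K).1‖)
  have hN : 0 ≤ N := Finset.sum_nonneg fun _ _ => Finset.sum_nonneg fun _ _ => by positivity
  obtain ⟨η, hη, hlev⟩ := exists_level_measure_le hΛ hc hh R (ε := ε / (N + 1)) (by positivity)
  refine ⟨η, hη, fun k hk v hv hvint hvu => ?_⟩
  -- On the intersection of one cell of each mesh, u is a single affine function and k a single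
  -- polynomial.
  set S : Set (Eucl (d + 1)) → Set (Eucl (d + 1)) → Set (Eucl (d + 1)) := fun K K' =>
    if 2 * (c / h) < ‖(p K).1‖ then
      {z | z ∈ interior K ∩ interior K' ∧ |(p K).1 z + (p K).2 - k z| ≤ η} else ∅
  have hlev' : ∀ K ∈ 𝒯, ∀ K' ∈ Λ, MeasurableSet (S K K') ∧
      volume (S K K') ≤ ENNReal.ofReal (ε / (N + 1)) := by
    intro K hK K' hK'
    have h₁ := hlev k hk K' hK' (interior K) measurableSet_interior
      (interior_subset.trans ((h𝒯.cell_subset hK).trans hR)) (p K).1 (p K).2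
    simp only [S]
    split_ifs with hif
    · exact ⟨h₁.1, h₁.2 hif⟩
    · simp
  set F₁ : Eucl (d + 1) → ℝ := fun z => divF f u z * Real.sign (u z - k z)
  set F₂ : Eucl (d + 1) → ℝ := fun z => |divF f v z - divF f u z|
  set F₃ : Eucl (d + 1) → ℝ := Ωr.indicator fun z => 2 * |divF f u z|
  set F₄ : Eucl (d + 1) → ℝ := Ωs.indicator fun _ => 4 * Cf * (c / h)
  set F₅ : Eucl (d + 1) → ℝ := fun z =>
    ∑ K ∈ 𝒯, ∑ K' ∈ Λ, (S K K').indicator (fun _ => 2 * (Cf * ‖(p K).1‖)) z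
  have hkm : AEMeasurable k (volume.restrict D) := aemeasurable_of_mem_Vhc hΛ hk.1
  have hsign : ∀ w : Eucl (d + 1) → ℝ, ContinuousOn w D → IntegrableOn (divF f w) D →
      IntegrableOn (fun z => divF f w z * Real.sign (w z - k z)) D := by
    intro w hw hwi
    refine Integrable.mul_bdd (c := 1) hwi ?_ (Eventually.of_forall fun z => ?_)
    · exact (measurable_sign.comp_aemeasurable
        ((hw.aemeasurable hDm).sub hkm)).aestronglyMeasurable
    · exact abs_sign_le_one _
  have hucont : ContinuousOn u D := hu.1.mono subset_closure
  have i₁ : IntegrableOn F₁ D := hsign u hucont hint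
  have i₂ : IntegrableOn F₂ D := (hvint.sub hint).abs
  have i₃ : IntegrableOn F₃ D := (hint.abs.const_mul 2).indicator hr
  have i₄ : IntegrableOn F₄ D := (integrable_const _).indicator hs
  have i₅' : ∀ K ∈ 𝒯, ∀ K' ∈ Λ, IntegrableOn
      (fun z => (S K K').indicator (fun _ => 2 * (Cf * ‖(p K).1‖)) z) D := fun K hK K' hK' =>
    (integrable_const _).indicator (hlev' K hK K' hK').1
  have i₅ : IntegrableOn F₅ D :=
    integrable_finsetSum _ fun K hK => integrable_finsetSum _ fun K' hK' => i₅' K hK K' hK'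
  have n₂ : ∀ z, 0 ≤ F₂ z := fun z => abs_nonneg _
  have n₃ : ∀ z, 0 ≤ F₃ z := fun z => indicator_nonneg (fun _ _ => by positivity) z
  have n₄ : ∀ z, 0 ≤ F₄ z := fun z => indicator_nonneg (fun _ _ => by positivity) z
  have n₅' : ∀ K K' z, 0 ≤ (S K K').indicator (fun _ => 2 * (Cf * ‖(p K).1‖)) z :=
    fun K K' z => indicator_nonneg (fun _ _ => by positivity) z
  have n₅ : ∀ z, 0 ≤ F₅ z := fun z =>
    Finset.sum_nonneg fun K _ => Finset.sum_nonneg fun K' _ => n₅' K K' z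
  have hpt : ∀ᵐ z ∂volume.restrict D, divF f v z * Real.sign (v z - k z)
      ≤ F₁ z + F₂ z + F₃ z + F₄ z + F₅ z := by
    filter_upwards [hdiv, ae_restrict_mem hDm, ae_restrict_of_ae hΛ.ae_mem_interior,
      ae_restrict_of_ae h𝒯.ae_mem_interior] with z hz hzD hzΛ hz𝒯
    obtain ⟨K', hK', hzK'⟩ := hzΛ hzD
    obtain ⟨K, hK, hzK⟩ := hz𝒯 hzD
    have hbase : divF f v z * Real.sign (v z - k z) ≤ F₁ z + F₂ z
        + divF f u z * (Real.sign (v z - k z) - Real.sign (u z - k z)) := by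
      have h₁ : (divF f v z - divF f u z) * Real.sign (v z - k z) ≤ F₂ z := by
        refine (le_abs_self _).trans ?_
        rw [abs_mul]
        exact mul_le_of_le_one_right (abs_nonneg _) (abs_sign_le_one _)
      simp only [F₁]
      linarith
    by_cases hclose : |u z - k z| ≤ η
    · have h₂ : divF f u z * (Real.sign (v z - k z) - Real.sign (u z - k z))
          ≤ 2 * |divF f u z| := by
        refine (le_abs_self _).trans ?_
        rw [abs_mul, mul_comm]
        refine mul_le_mul_of_nonneg_right ?_ (abs_nonneg _)
        have h₃ := abs_sign_le_one (v z - k z)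
        have h₄ := abs_sign_le_one (u z - k z)
        rw [abs_le] at h₃ h₄ ⊢
        constructor <;> linarith
      rw [hrs] at hzD
      rcases hzD with hzr | hzs
      · have h₃ : F₃ z = 2 * |divF f u z| := indicator_of_mem hzr _
        linarith [n₄ z, n₅ z]
      · have hfd : fderiv ℝ u z = (p K).1 := by
          have e : u =ᶠ[𝓝 z] fun y => (p K).1 y + (p K).2 := by
            filter_upwards [isOpen_interior.mem_nhds hzK] with y hy
            exact hp K hK y (interior_subset hy)
          rw [e.fderiv_eq, fderiv_add_const, ContinuousLinearMap.fderiv]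
        rw [hfd] at hz
        by_cases hsteep : 2 * (c / h) < ‖(p K).1‖
        · have hzS : z ∈ S K K' := by
            simp only [S, if_pos hsteep]
            refine ⟨⟨hzK, hzK'⟩, ?_⟩
            rwa [← hp K hK z (interior_subset hzK)]
          have h₅ : 2 * (Cf * ‖(p K).1‖) ≤ F₅ z := by
            have e : (S K K').indicator (fun _ => 2 * (Cf * ‖(p K).1‖)) z
                = 2 * (Cf * ‖(p K).1‖) := indicator_of_mem hzS _
            rw [← e]
            exact (Finset.single_le_sum (f := fun K' =>
                (S K K').indicator (fun _ => 2 * (Cf * ‖(p K).1‖)) z)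
              (fun K' _ => n₅' K K' z) hK').trans (Finset.single_le_sum (f := fun K => ∑ K' ∈ Λ,
                (S K K').indicator (fun _ => 2 * (Cf * ‖(p K).1‖)) z)
              (fun K _ => Finset.sum_nonneg fun K' _ => n₅' K K' z) hK)
          linarith [n₃ z, n₄ z]
        · have h₄ : F₄ z = 4 * Cf * (c / h) := indicator_of_mem hzs _
          have h₅ : Cf * ‖(p K).1‖ ≤ Cf * (2 * (c / h)) :=
            mul_le_mul_of_nonneg_left (not_lt.1 hsteep) hCf.le
          linarith [n₃ z, n₅ z]
    · have hse : Real.sign (v z - k z) = Real.sign (u z - k z) := by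
        refine sign_eq_of_abs_sub_lt (η := η) ?_ (not_le.1 hclose)
        rw [sub_sub_sub_cancel_right]
        exact hvu z hzD
      rw [hse, sub_self, mul_zero] at hbase
      rw [hse]
      linarith [n₃ z, n₄ z, n₅ z]
  have hmono := integral_mono_ae (hsign v hv hvint)
    ((((i₁.add i₂).add i₃).add i₄).add i₅) hpt
  have e₅ : ∫ z in D, F₅ z ≤ ε := by
    have h₁ : ∫ z in D, F₅ z = ∑ K ∈ 𝒯, ∑ K' ∈ Λ,
        ∫ z in D, (S K K').indicator (fun _ => 2 * (Cf * ‖(p K).1‖)) z := by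
      simp only [F₅]
      rw [integral_finsetSum _ fun K hK => integrable_finsetSum _ fun K' hK' => i₅' K hK K' hK']
      exact Finset.sum_congr rfl fun K hK => integral_finsetSum _ fun K' hK' => i₅' K hK K' hK'
    have h₂ : ∀ K ∈ 𝒯, ∀ K' ∈ Λ,
        ∫ z in D, (S K K').indicator (fun _ => 2 * (Cf * ‖(p K).1‖)) z
          ≤ 2 * (Cf * ‖(p K).1‖) * (ε / (N + 1)) := by
      intro K hK K' hK'
      rw [setIntegral_indicator (hlev' K hK K' hK').1, setIntegral_const, smul_eq_mul, mul_comm]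
      refine mul_le_mul_of_nonneg_left ?_ (by positivity)
      refine ENNReal.toReal_le_of_le_ofReal (by positivity) ?_
      exact (measure_mono inter_subset_right).trans (hlev' K hK K' hK').2
    rw [h₁]
    calc _ ≤ ∑ K ∈ 𝒯, ∑ K' ∈ Λ, 2 * (Cf * ‖(p K).1‖) * (ε / (N + 1)) :=
          Finset.sum_le_sum fun K hK => Finset.sum_le_sum fun K' hK' => h₂ K hK K' hK'
      _ = N * (ε / (N + 1)) := by simp only [N, Finset.sum_mul]
      _ = ε * (N / (N + 1)) := by ring
      _ ≤ ε := mul_le_of_le_one_right hε.le ((div_le_one (by positivity)).2 (by linarith))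
  -- The bound h² on the volume of Ω_s absorbs the gradient bound 1/h and leaves one power of h.
  have e₄ : ∫ z in D, F₄ z ≤ 4 * c * Cf * CΩ * h := by
    simp only [F₄]
    rw [setIntegral_indicator hs, setIntegral_const, smul_eq_mul]
    have h₁ : volume.real (D ∩ Ωs) ≤ CΩ * h ^ 2 :=
      ENNReal.toReal_le_of_le_ofReal (by positivity)
        ((measure_mono inter_subset_right).trans hvol)
    calc volume.real (D ∩ Ωs) * (4 * Cf * (c / h)) ≤ CΩ * h ^ 2 * (4 * Cf * (c / h)) :=
          mul_le_mul_of_nonneg_right h₁ (by positivity)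
      _ = 4 * c * Cf * CΩ * h := by field_simp
  have e₃ : ∫ z in D, F₃ z = 2 * ∫ z in Ωr, |divF f u z| := by
    have hsub : D ∩ Ωr = Ωr := inter_eq_right.2 (hrs ▸ subset_union_left)
    simp only [F₃]
    rw [setIntegral_indicator hr, hsub, integral_const_mul]
  rw [integral_add' (((i₁.add i₂).add i₃).add i₄) i₅, integral_add' ((i₁.add i₂).add i₃) i₄,
    integral_add' (i₁.add i₂) i₃, integral_add' i₁ i₂, e₃] at hmono
  simp only [entropyResidual]
  linarith

theorem zero_mem_Vhc {n : ℕ} (cells : Finset (Set (Eucl n))) (c : ℝ) :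
    (0 : Eucl n → ℝ) ∈ Vhc cells c := by
  refine ⟨fun K _ => ⟨0, fun _ i => by simp, fun _ => by simp, fun z _ => by simp⟩, ?_⟩
  have hg : gradient (0 : Eucl n → ℝ) = 0 := by
    ext1 z
    simp [gradient]
  simp [normW1h, hg]

/-- Bounds the family of residuals above, so that the real supremum in the entropy loss dominates
each of its members. -/
theorem entropyResidual_le {f : ℝ → Eucl d} {Ω : Set (Eucl d)} {T : ℝ} {v : Eucl (d + 1) → ℝ}
    (hint : IntegrableOn (divF f v) (cylinder Ω T)) (k : Eucl (d + 1) → ℝ) :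
    entropyResidual f Ω T v k ≤ ∫ z in cylinder Ω T, |divF f v z| := by
  rw [entropyResidual]
  refine (le_abs_self _).trans ?_
  rw [← Real.norm_eq_abs]
  refine norm_integral_le_of_norm_le hint.abs (Eventually.of_forall fun z => ?_)
  rw [norm_mul]
  exact mul_le_of_le_one_right (norm_nonneg _) (abs_sign_le_one _)

theorem lossEnt_le {f : ℝ → Eucl d} {Ω : Set (Eucl d)} {T : ℝ}
    {Λ : Finset (Set (Eucl (d + 1)))} {c E : ℝ} {u v : Eucl (d + 1) → ℝ}
    (hint : IntegrableOn (divF f u) (cylinder Ω T))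
    (hE : ∀ k ∈ Vhc Λ c, entropyResidual f Ω T v k ≤ entropyResidual f Ω T u k + E) :
    lossEnt f Ω T Λ c v ≤ lossEnt f Ω T Λ c u + E := by
  have : Nonempty (Vhc Λ c) := ⟨⟨0, zero_mem_Vhc Λ c⟩⟩
  refine ciSup_le fun k => (hE k k.2).trans (add_le_add_left ?_ _)
  refine le_ciSup (f := fun k : Vhc Λ c => entropyResidual f Ω T u k) ?_ k
  refine ⟨∫ z in cylinder Ω T, |divF f u z|, ?_⟩
  rintro _ ⟨k, rfl⟩
  exact entropyResidual_le hint k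

theorem lossReg_le {f : ℝ → Eucl d} {Ω : Set (Eucl d)} {T : ℝ}
    {Λ : Finset (Set (Eucl (d + 1)))} {u v : Eucl (d + 1) → ℝ} (hh : 0 ≤ meshSize Λ)
    (hu : IntegrableOn (divF f u) (cylinder Ω T)) (hv : IntegrableOn (divF f v) (cylinder Ω T)) :
    lossReg f Ω T Λ v ≤ lossReg f Ω T Λ u
      + meshSize Λ * ∫ z in cylinder Ω T, |divF f v z - divF f u z| := by
  have hd : IntegrableOn (fun z => |divF f v z - divF f u z|) (cylinder Ω T) := (hv.sub hu).abs
  rw [lossReg, lossReg, ← mul_add, ← integral_add hu.abs hd]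
  refine mul_le_mul_of_nonneg_left (integral_mono hv.abs (hu.abs.add hd) fun z => ?_) hh
  have := abs_add_le (divF f u z) (divF f v z - divF f u z)
  rwa [add_sub_cancel] at this

theorem integral_abs_sub_le {α : Type*} [MeasurableSpace α] {μ : Measure α} {S : Set α}
    (hS : μ S < ∞) (hSm : MeasurableSet S) {a b w : α → ℝ} {η : ℝ}
    (hb : IntegrableOn (fun x => b x - w x) S μ) (ha : IntegrableOn (fun x => a x - w x) S μ)
    (hab : ∀ x ∈ S, |a x - b x| ≤ η) :
    ∫ x in S, |a x - w x| ∂μ ≤ (∫ x in S, |b x - w x| ∂μ) + μ.real S * η := by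
  have hi : IntegrableOn (fun _ => η) S μ := integrableOn_const hS.ne
  have h₁ : ∫ x in S, |a x - w x| ∂μ ≤ ∫ x in S, (|b x - w x| + η) ∂μ := by
    refine setIntegral_mono_on ha.abs (hb.abs.add hi) hSm fun x hx => ?_
    have h₂ := abs_add_le (b x - w x) (a x - b x)
    have e : b x - w x + (a x - b x) = a x - w x := by ring
    rw [e] at h₂
    linarith [hab x hx]
  rwa [integral_add hb.abs hi, setIntegral_const, smul_eq_mul] at h₁

theorem integrableOn_of_continuousOn_compact {α : Type*} [MeasurableSpace α] [TopologicalSpace α]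
    [OpensMeasurableSpace α] {μ : Measure α} {S K : Set α} (hS : μ S < ∞) (hSm : MeasurableSet S)
    (hK : IsCompact K) (hSK : S ⊆ K) {a : α → ℝ} (ha : ContinuousOn a K) : IntegrableOn a S μ := by
  obtain ⟨C, hC⟩ := hK.exists_bound_of_continuousOn ha
  refine ⟨((ha.mono hSK).aemeasurable hSm).aestronglyMeasurable, ?_⟩
  refine HasFiniteIntegral.restrict_of_bounded C hS ?_
  filter_upwards [ae_restrict_mem hSm] with x hx using hC x (hSK hx)

theorem measurableSet_lateralBoundary (Ω : Set (Eucl d)) (T : ℝ) :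
    MeasurableSet (lateralBoundary Ω T) :=
  ((isClosed_frontier.preimage lipschitzWith_spacePart.continuous).measurableSet).inter
    ((isOpen_Ioo.preimage continuous_timePart).measurableSet)

theorem lossIbc_le {Ω : Set (Eucl d)} {T : ℝ} {u₀ : Eucl d → ℝ} {u v : Eucl (d + 1) → ℝ} {η : ℝ}
    (hΩo : IsOpen Ω) (hΩb : Bornology.IsBounded Ω) (hΩ : HasLipschitzBoundary Ω) (hT : 0 < T)
    (hu₀ : MemLp u₀ ∞ volume) (hu : ContinuousOn u (closure (cylinder Ω T)))
    (hv : ContinuousOn v (closure (cylinder Ω T)))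
    (huv : ∀ z ∈ closure (cylinder Ω T), |v z - u z| ≤ η) :
    lossIbc Ω T u₀ v ≤ lossIbc Ω T u₀ u
      + (volume.real Ω * η + (μHE[d]).real (lateralBoundary Ω T) * η) := by
  have hfin : volume Ω < ∞ := hΩb.measure_lt_top
  have hfinm : IsFiniteMeasure (volume.restrict Ω) := ⟨by
    rwa [Measure.restrict_apply_univ]⟩
  have hu₀i : IntegrableOn u₀ Ω :=
    (hu₀.restrict Ω).integrable le_top
  have htrace : ∀ w : Eucl (d + 1) → ℝ, ContinuousOn w (closure (cylinder Ω T)) →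
      IntegrableOn (fun x => w (stPoint x 0) - u₀ x) Ω := by
    intro w hw
    refine Integrable.sub ?_ hu₀i
    refine integrableOn_of_continuousOn_compact hfin hΩo.measurableSet hΩb.isCompact_closure
      subset_closure (hw.comp (Continuous.continuousOn ?_) fun x hx =>
        stPoint_mem_closure_cylinder hT hx ⟨le_rfl, hT.le⟩)
    exact continuous_stPoint.comp (Continuous.prodMk_left 0)
  have hlat := lateralBoundary_measure_lt_top hΩb hΩ T
  have hlati : ∀ w : Eucl (d + 1) → ℝ, ContinuousOn w (closure (cylinder Ω T)) →
      IntegrableOn (fun z => w z - 0) (lateralBoundary Ω T) μHE[d] := by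
    intro w hw
    simp only [sub_zero]
    exact integrableOn_of_continuousOn_compact hlat (measurableSet_lateralBoundary Ω T)
      (isBounded_cylinder hΩb T).isCompact_closure (lateralBoundary_subset_closure hT) hw
  have h₁ := integral_abs_sub_le hfin hΩo.measurableSet (htrace u hu) (htrace v hv)
    fun x hx => huv _ (stPoint_mem_closure_cylinder hT (subset_closure hx) ⟨le_rfl, hT.le⟩)
  have h₂ := integral_abs_sub_le hlat (measurableSet_lateralBoundary Ω T) (hlati u hu) (hlati v hv)
    fun z hz => huv z (lateralBoundary_subset_closure hT hz)
  simp only [sub_zero] at h₂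
  simp only [lossIbc]
  linarith

theorem clip_eq_self {c r : ℝ} (hr : |r| ≤ c / 2) : clip c r = r := by
  have h := abs_le.1 hr
  rw [clip, max_eq_left h.1, min_eq_left h.2]

end Loss

/-! ### Choice of the network and the final estimate -/

theorem lemma2p2 (d : ℕ) (hd : 1 ≤ d) :
    -- the architecture constants depend on the dimension only
    ∃ C₁ C₂ C₃ : ℕ,
    ∀ (Ω : Set (Eucl d)) (T : ℝ) (f : ℝ → Eucl d) (c CΩ Cgrad κ : ℝ),
      IsOpen Ω → IsConnected Ω → Bornology.IsBounded Ω → HasLipschitzBoundary Ω →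
      0 < T → ContDiff ℝ 2 f → 0 < c → 0 < CΩ → 0 < Cgrad → 0 < κ →
    ∃ C : ℝ, 0 < C ∧
    ∀ (u₀ : Eucl d → ℝ) (δc : ℝ)
      (Λ : Finset (Set (Eucl (d + 1)))) (𝒯 : Finset (Set (Eucl (d + 1)))) (Npatch : ℕ)
      (û : Eucl (d + 1) → ℝ) (Ωr Ωs : Set (Eucl (d + 1))),
      -- the initial datum
      MemLp u₀ ∞ volume → HasCompactSupport u₀ →
      -- the background mesh, of size `h = meshSize Λ`
      IsConformingPartition Λ (cylinder Ω T) → IsShapeRegular κ Λ → IsQuasiUniform κ Λ →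
      -- the CPwL function
      IsSimplicialPartition 𝒯 (cylinder Ω T) → PatchBound 𝒯 Npatch →
      IsCPwL 𝒯 (cylinder Ω T) û →
      0 < δc → (∀ z ∈ cylinder Ω T, |û z| ≤ c / 2 - δc) →
      eLpNorm (gradient û) 1 (volume.restrict (cylinder Ω T)) ≤ ENNReal.ofReal Cgrad →
      -- the regular and the singular part
      MeasurableSet Ωr → MeasurableSet Ωs →
      HasLipschitzBoundary Ωr → HasLipschitzBoundary Ωs →
      cylinder Ω T = Ωr ∪ Ωs → Disjoint Ωr Ωs →
      μHE[d] (frontier Ωs) ≤ ENNReal.ofReal CΩ →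
      volume Ωs ≤ ENNReal.ofReal (CΩ * meshSize Λ ^ 2) →
      -- on the regular part, the function is piecewise linear on a shape-regular mesh of size `O(h)`
      (∃ 𝒯r : Finset (Set (Eucl (d + 1))), IsSimplicialPartition 𝒯r Ωr ∧ IsShapeRegular κ 𝒯r ∧
        meshSize 𝒯r ≤ κ * meshSize Λ ∧ ∀ K ∈ 𝒯r, ∃ A : Eucl (d + 1) →ᵃ[ℝ] ℝ, EqOn û A K) →
      ∃ θ : NetParams (d + 1),
        θ.depth ≤ C₁ * Nat.clog 2 Npatch + C₂ ∧
        θ.width ≤ C₃ * (𝒯.card * Npatch) ∧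
        loss f Ω T u₀ Λ c (clippedNet c θ)
          ≤ loss f Ω T u₀ Λ c û + C * (meshSize Λ + ∫ z in Ωr, |divF f û z|) := by
  -- Two hidden layers for each level of the maximum tree and four more, plus the affine output map;
  -- the width factor is 6(n+1)(n+2) with n = d + 1.
  refine ⟨2, 5, 6 * (d + 2) * (d + 3), ?_⟩
  intro Ω T f c CΩ Cgrad κ hΩo hΩconn hΩb hΩL hT hf hc hCΩ _ _
  obtain ⟨Cf, hCf, hflux⟩ := exists_fluxForm_bound hf (c / 2)
  -- Four multiples of h arise: the L¹ distance of the residuals, the steep level sets, the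
  -- regularization term, and the initial and boundary terms. The non-steep part of Ω_s adds
  -- 4c·Cf·CΩ·h. The integral over Ω_r needs only the factor 2.
  refine ⟨5 + 4 * c * Cf * CΩ, by positivity, ?_⟩
  intro u₀ δc Λ 𝒯 Npatch û Ωr Ωs hu₀ _ hΛ _ _ h𝒯 hpatch hû hδ hbound _ hr hs _ _ hrs _ _ hvol _
  set D := cylinder Ω T
  set h := meshSize Λ
  have hDo : IsOpen D := isOpen_cylinder hΩo T
  have hDb : Bornology.IsBounded D := isBounded_cylinder hΩb T
  have hDne : D.Nonempty := by
    obtain ⟨x, hx⟩ := hΩconn.nonempty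
    exact ⟨stPoint x (T / 2), by simpa using hx, by simp [hT]⟩
  have hh : 0 < h := hΛ.meshSize_pos hDb hDne
  obtain ⟨g, ⟨H, hH, hreal⟩, hgu⟩ := exists_netLimit_eqOn h𝒯 hpatch hû
  obtain ⟨B, hB, hBg⟩ := hH.exists_lipschitz
  have hbound' : ∀ z ∈ closure D, |û z| ≤ c / 2 - δc := fun z hz =>
    le_on_closure hbound hû.1.abs continuousOn_const hz
  -- the residual of the piecewise linear function
  have hug : ∀ z ∈ D, û =ᶠ[𝓝 z] g := fun z hz => by
    filter_upwards [hDo.mem_nhds hz] with y hy using (hgu (subset_closure hy)).symm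
  have hdivg : ∀ z ∈ D, divF f û z = divF f g z := fun z hz => divF_congr (hug z hz)
  have hdiv : ∀ᵐ z ∂volume.restrict D, |divF f û z| ≤ Cf * ‖fderiv ℝ û z‖ := by
    obtain ⟨A, -, hA⟩ := hH.fderiv_tendsto
    filter_upwards [ae_restrict_of_ae hA, ae_restrict_mem hDo.measurableSet] with z ⟨p, _, e, _⟩ hz
    have hdiff : DifferentiableAt ℝ û z := by
      refine DifferentiableAt.congr_of_eventuallyEq ?_ ((hug z hz).trans e)
      exact (p.1.differentiable.add_const p.2) z
    rw [divF_eq_fluxForm hf hdiff]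
    exact hflux _ ((hbound z hz).trans (by linarith)) _
  have hfd : ∀ z ∈ D, ‖fderiv ℝ û z‖ ≤ B := fun z hz => by
    rw [(hug z hz).fderiv_eq]
    exact norm_fderiv_le_of_lipschitz ℝ hBg
  have hint : IntegrableOn (divF f û) D := by
    refine Measure.integrableOn_of_bounded hDb.measure_lt_top.ne
      (measurable_divF f û).aestronglyMeasurable (M := Cf * B) ?_
    filter_upwards [hdiv, ae_restrict_mem hDo.measurableSet] with z hz hzD
    exact hz.trans (mul_le_mul_of_nonneg_left (hfd z hzD) hCf.le)
  obtain ⟨η, hη, hent⟩ := exists_entropyResidual_le hDo hDb hΛ hh h𝒯.1 hû hc hCΩ hCf hdiv hint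
    hr hs hrs hvol hh
  -- a network that is close enough
  set V := volume.real Ω
  set A := (μHE[d]).real (lateralBoundary Ω T)
  have hV : 0 ≤ V := measureReal_nonneg
  have hA : 0 ≤ A := measureReal_nonneg
  -- Here η preserves signs away from the level sets, δc makes the clipping inactive, and the last
  -- bound keeps the initial and boundary errors below h.
  set τ := min (min η δc) (h / (V + A + 1))
  have hτ : 0 < τ := lt_min (lt_min hη hδ) (by positivity)
  have hlim := hH.tendsto_integral_divF hf hDo.measurableSet hDb
  -- The L¹ distance of the residuals is below h for the entropy term and below 1 for the
  -- regularization term, which carries its own factor h.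
  obtain ⟨k, hk₁, hk₂⟩ := ((hH.eventually_abs_sub_lt hDb.closure hτ).and
    (hlim.eventually_lt_const (lt_min hh one_pos))).exists
  obtain ⟨θ, hθd, hθw, hθ⟩ := (hreal k).exists_netParams
  refine ⟨θ, by omega, hθw.trans_eq (by ring), ?_⟩
  set v := clippedNet c θ
  have hclose : ∀ z ∈ closure D, |H k z - û z| < τ := fun z hz => by
    rw [← hgu hz]
    exact hk₁ z hz
  have hHk : ∀ z ∈ closure D, |H k z| ≤ c / 2 := fun z hz => by
    have h₁ := abs_add_le (H k z - û z) (û z)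
    rw [sub_add_cancel] at h₁
    have h₂ : τ ≤ δc := (min_le_left _ _).trans (min_le_right _ _)
    linarith [hclose z hz, hbound' z hz]
  have hvH : ∀ z ∈ closure D, v z = H k z := fun z hz => by
    simp only [v, clippedNet, hθ]
    exact clip_eq_self (hHk z hz)
  have hvdiv : ∀ z ∈ D, divF f v z = divF f (H k) z := fun z hz => divF_congr (by
    filter_upwards [hDo.mem_nhds hz] with y hy using hvH y (subset_closure hy))
  have hvint : IntegrableOn (divF f v) D := by
    refine Measure.integrableOn_of_bounded hDb.measure_lt_top.ne
      (measurable_divF f v).aestronglyMeasurable (M := Cf * B) ?_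
    filter_upwards [ae_restrict_mem hDo.measurableSet] with z hz
    rw [hvdiv z hz, divF_eq_fluxForm hf (hH.differentiable k z)]
    exact (hflux _ (hHk z (subset_closure hz)) _).trans (mul_le_mul_of_nonneg_left
      (norm_fderiv_le_of_lipschitz ℝ (hB k)) hCf.le)
  have hvcont : ContinuousOn v (closure D) :=
    (hB k).continuous.continuousOn.congr hvH
  have hvclose : ∀ z ∈ closure D, |v z - û z| < τ := fun z hz => by
    rw [hvH z hz]
    exact hclose z hz
  have hdiff : ∫ z in D, |divF f v z - divF f û z| < min h 1 := by
    rw [setIntegral_congr_fun hDo.measurableSet (g := fun z => |divF f (H k) z - divF f g z|)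
      fun z hz => by simp only [hvdiv z hz, hdivg z hz]]
    exact hk₂
  -- comparison of the three parts of the loss
  have hE := lossEnt_le (Λ := Λ) (c := c) (v := v) (E := (∫ z in D, |divF f v z - divF f û z|)
      + 2 * (∫ z in Ωr, |divF f û z|) + 4 * c * Cf * CΩ * h + h) hint fun k hk => by
    have : entropyResidual f Ω T v k ≤ entropyResidual f Ω T û k
        + (∫ z in D, |divF f v z - divF f û z|) + 2 * (∫ z in Ωr, |divF f û z|)
        + 4 * c * Cf * CΩ * h + h := hent k hk v (hvcont.mono subset_closure) hvint fun z hz =>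
      (hvclose z (subset_closure hz)).trans_le ((min_le_left _ _).trans (min_le_left _ _))
    linarith
  have hR : lossReg f Ω T Λ v
      ≤ lossReg f Ω T Λ û + h * ∫ z in D, |divF f v z - divF f û z| :=
    lossReg_le hh.le hint hvint
  have hI : lossIbc Ω T u₀ v ≤ lossIbc Ω T u₀ û + (V * τ + A * τ) :=
    lossIbc_le hΩo hΩb hΩL hT hu₀ hû.1 hvcont fun z hz => (hvclose z hz).le
  have hR' : h * ∫ z in D, |divF f v z - divF f û z| ≤ h :=
    mul_le_of_le_one_right hh.le (hdiff.le.trans (min_le_right _ _))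
  have hI' : V * τ + A * τ ≤ h := by
    have h₁ : τ ≤ h / (V + A + 1) := min_le_right _ _
    rw [le_div_iff₀ (by positivity)] at h₁
    have h₂ : V * τ + A * τ = τ * (V + A + 1) - τ := by ring
    linarith
  have hdiff' := hdiff.le.trans (min_le_left _ _)
  have hreg : 0 ≤ ∫ z in Ωr, |divF f û z| := integral_nonneg fun z => abs_nonneg _
  have hreg' : 0 ≤ (3 + 4 * c * Cf * CΩ) * ∫ z in Ωr, |divF f û z| := by positivity
  simp only [loss]
  linarith
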